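/- For $\nu>-1$ let $J_\nu(x)=\sum_{m\ge 0}\frac{(-1)^m}{m!\,\Gamma(m+\nu+1)}\left(\frac{x}{2}\right)^{2m+\nu}$, $x>0$, be the Bessel function of the first kind. It has infinitely many positive zeros, which can be listed in increasing order as $0<j_{\nu,1}<j_{\nu,2}<\cdots$, and for every $k\in\{1,2,\dots\}$ (both series being convergent) $$\sum_{n\ge 1,\ n\ne k}\frac{1}{j_{\nu,n}^4-j_{\nu,k}^4}=-\frac{1}{2j_{\nu,k}^2}\sum_{n\ge 1}\frac{1}{j_{\nu,n}^2+j_{\nu,k}^2}+\frac{\nu+2}{4j_{\nu,k}^4}.$$ In particular, for all $k\in\{1,2,\dots\}$, $$\sum_{n\ge 1,\ n\ne k}\frac{1}{n^4-k^4}=-\frac{\pi}{4k^3}\coth(k\pi)+\frac{7}{8k^4}.$$ Moreover, for all $k\in\{1,3,5,\dots\}$, $$\sum_{\substack{n\ge 1,\ n\ne k\\ n\text{ odd}}}\frac{1}{n^4-k^4}=-\frac{\pi}{8k^3}\tanh\left(\frac{k\pi}{2}\right)+\frac{3}{8k^4}.$$ -/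

import Mathlib

noncomputable section

/-- The Bessel function of the first kind of real order `ν`, given on `(0, ∞)` by its series
`J_ν(x) = ∑_{m ≥ 0} (-1)^m / (m! Γ(m + ν + 1)) * (x / 2)^(2m + ν)`. It is only used for `0 < x`. -/
def besselJ (ν x : ℝ) : ℝ :=
  ∑' m : ℕ, (-1 : ℝ) ^ m / ((m.factorial : ℝ) * Real.Gamma ((m : ℝ) + ν + 1)) *
    (x / 2) ^ (2 * (m : ℝ) + ν)

/-- For `1 ≤ n`, `besselJZero ν n` is the `n`th positive zero `j_{ν,n}` of `J_ν`, in increasing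
order: the first one is the least positive zero, and each further one is the least zero that is
larger than the one before. The value `0` at the index `0` is a convention that starts the
recursion. -/
def besselJZero (ν : ℝ) : ℕ → ℝ
  | 0 => 0
  | n + 1 => sInf {x : ℝ | besselJZero ν n < x ∧ besselJ ν x = 0}

end

/-! Write `J_ν(x) = (x/2)^ν Λ(x²/4)` with `Λ = besselEntire ν`. This entire function has
subexponential growth and satisfies `zΛ'' + (ν+1)Λ' + Λ = 0`. Its zeros are positive, simple and
infinite in number.

An entire function `h` of subexponential growth with simple zeros `ρ` satisfies `h'(w)/h(w) = -∑
1/(ρ - w)`, summed over growing discs about `w`. Let `x` be a zero of `Λ` and `h(z) = Λ(z)/(z - x)`.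
At `w = x` the left side is `Λ''(x)/(2Λ'(x))`, which the differential equation evaluates as
`-(ν+1)/(2x)`. Hence `∑ 1/(y - x) = (ν+1)/(2x)` over the other zeros `y`
(`hasSum_inv_sub_besselEntire_zeros`). With `x = j_k²/4` this gives `∑ 1/(j_n² - j_k²) =
(ν+1)/(2j_k²)`, and partial fractions pass to fourth powers (`hasSum_one_div_pow_four_sub`).

The two integer series correspond to `ν = ±1/2`, but the quadratic sums they need are computed
directly, by telescoping and from the cotangent series. -/

section

open Filter Topology Metric

/-! ### Entire functions of subexponential growth -/

/-- `h` grows more slowly than every exponential `exp (ε ‖z‖)`. -/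
def SubexponentialGrowth (h : ℂ → ℂ) : Prop :=
  ∀ ε : ℝ, 0 < ε → ∃ C : ℝ, ∀ z, ‖h z‖ ≤ C * Real.exp (ε * ‖z‖)

/-- The zeros are divided out one at a time. A factor `1 - z / ρ` vanishes only at `ρ`, so the
remaining zeros pass to the quotient. -/
theorem Complex.exists_eq_prod_mul {h : ℂ → ℂ} (hd : Differentiable ℂ h) (S : Finset ℂ)
    (hS : ∀ ρ ∈ S, h ρ = 0) (hS0 : (0 : ℂ) ∉ S) :
    ∃ g : ℂ → ℂ, Differentiable ℂ g ∧ ∀ z, h z = (∏ ρ ∈ S, (1 - z / ρ)) * g z := by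
  classical
  induction S using Finset.induction_on with
  | empty => exact ⟨h, hd, by simp⟩
  | insert a S ha ih =>
    obtain ⟨g, hg, hgz⟩ := ih (fun ρ hρ => hS ρ (Finset.mem_insert_of_mem hρ))
      (fun h0 => hS0 (Finset.mem_insert_of_mem h0))
    have ha0 : a ≠ 0 := fun h0 => hS0 (h0 ▸ Finset.mem_insert_self _ _)
    have hga : g a = 0 := by
      have := hgz a
      rw [hS a (Finset.mem_insert_self _ _)] at this
      rcases mul_eq_zero.1 this.symm with h1 | h1
      · obtain ⟨ρ, hρ, h2⟩ := Finset.prod_eq_zero_iff.1 h1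
        have hρ0 : ρ ≠ 0 := fun h0 => hS0 (h0 ▸ Finset.mem_insert_of_mem hρ)
        have : a = ρ := by field_simp at h2; linear_combination -h2
        exact absurd (this ▸ hρ) ha
      · exact h1
    refine ⟨fun z => -a * dslope g a z, ?_, fun z => ?_⟩
    · have := (Complex.differentiableOn_dslope (f := g) (s := Set.univ) (c := a) univ_mem).2
        hg.differentiableOn
      exact (differentiableOn_univ.1 this).const_mul _
    · have := sub_smul_dslope g a z
      rw [hga, sub_zero, smul_eq_mul] at this
      rw [Finset.prod_insert ha, hgz z, ← this]
      field_simp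
      ring

/-- A nowhere vanishing holomorphic function on a ball whose modulus is at most
`exp M` times its value at the centre has logarithmic derivative at most `4 M / R` there. -/
theorem Complex.norm_logDeriv_zero_le {g : ℂ → ℂ} {R M : ℝ} (hR : 0 < R) (hM : 0 < M)
    (hg : Differentiable ℂ g) (hne : ∀ z ∈ ball (0 : ℂ) R, g z ≠ 0)
    (hb : ∀ z ∈ ball (0 : ℂ) R, ‖g z‖ ≤ ‖g 0‖ * Real.exp M) :
    ‖deriv g 0 / g 0‖ ≤ 4 * M / R := by
  have h0 : (0 : ℂ) ∈ ball (0 : ℂ) R := mem_ball_self hR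
  have hg' : Differentiable ℂ (deriv g) := by
    have := hg.contDiff (n := 2)
    exact (this.differentiable_deriv_two)
  have hdiv : DifferentiableOn ℂ (fun z => deriv g z / g z) (ball 0 R) :=
    hg'.differentiableOn.div hg.differentiableOn hne
  -- `L` is the holomorphic logarithm of `g / g 0` on the ball, normalised by `L 0 = 0`.
  obtain ⟨L, hL0, hL⟩ := hdiv.isExactOn_ball.with_val_at 0 0
  have hLd : DifferentiableOn ℂ L (ball 0 R) :=
    fun z hz => (hL z hz).differentiableAt.differentiableWithinAt
  have hconst : ∀ z ∈ ball (0 : ℂ) R, g z * Complex.exp (-L z) = g 0 := by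
    intro z hz
    have hder : ∀ y ∈ ball (0 : ℂ) R, HasDerivAt (fun z => g z * Complex.exp (-L z)) 0 y := by
      intro y hy
      have h1 := (hg y).hasDerivAt.mul ((hL y hy).neg.cexp)
      refine h1.congr_deriv ?_
      have := hne y hy
      field_simp
      ring
    have := (convex_ball (0 : ℂ) R).is_const_of_fderivWithin_eq_zero (𝕜 := ℂ)
      (f := fun z => g z * Complex.exp (-L z))
      (fun y hy => (hder y hy).differentiableAt.differentiableWithinAt)
      (fun y hy => by
        rw [fderivWithin_of_isOpen isOpen_ball hy]
        ext
        simpa using (hder y hy).deriv) hz h0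
    simpa [hL0] using this
  have hre : Set.MapsTo L (ball 0 R) {z | z.re ≤ M} := by
    intro z hz
    have h1 := hconst z hz
    have h2 : g z = g 0 * Complex.exp (L z) := by
      rw [← h1, mul_assoc, ← Complex.exp_add]; simp
    have h3 := hb z hz
    rw [h2, norm_mul, Complex.norm_exp] at h3
    exact Real.exp_le_exp.1 (le_of_mul_le_mul_left h3 (norm_pos_iff.2 (hne 0 h0)))
  -- Borel–Carathéodory at radius `R / 2` gives `2M`; Cauchy's estimate on that circle then gives
  -- `2M / (R / 2)`.
  have hsph : ∀ z ∈ sphere (0 : ℂ) (R / 2), ‖L z‖ ≤ 2 * M := by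
    intro z hz
    have hz' : ‖z‖ = R / 2 := by simpa using hz
    have := Complex.borelCaratheodory_zero hM hLd hre hR
      (z := z) (by rw [mem_ball_zero_iff]; linarith) hL0
    rw [hz'] at this
    refine this.trans (le_of_eq ?_)
    field_simp
    ring
  have hcl : closedBall (0 : ℂ) (R / 2) ⊆ ball 0 R := closedBall_subset_ball (by linarith)
  have := Complex.norm_deriv_le_of_forall_mem_sphere_norm_le (f := L) (c := 0) (half_pos hR)
    (DifferentiableOn.diffContOnCl (by
      rw [closure_ball _ (half_pos hR).ne']; exact hLd.mono hcl)) hsph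
  rw [(hL 0 h0).deriv] at this
  refine this.trans (le_of_eq ?_)
  field_simp
  ring

/-- Dividing out the zeros in the disc of radius `R` leaves `g` without zeros in the open disc. On
the circle of radius `3R` each factor `1 - w / ρ` has modulus at least `3 - 1`, so there `g` is no
larger than `h`, and the maximum principle carries the bound inwards. The `+ 1` keeps the exponent
positive. -/
theorem Complex.norm_logDeriv_add_sum_inv_le {h : ℂ → ℂ} {R B : ℝ} (hR : 0 < R)
    (hd : Differentiable ℂ h) (h0 : h 0 ≠ 0) (hs : ∀ z, h z = 0 → deriv h z ≠ 0)
    (S : Finset ℂ) (hS : ∀ z, z ∈ S ↔ h z = 0 ∧ ‖z‖ ≤ R)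
    (hB : ∀ z, ‖z‖ ≤ 3 * R → ‖h z‖ ≤ B) :
    ‖deriv h 0 / h 0 + ∑ ρ ∈ S, ρ⁻¹‖ ≤ 4 * (Real.log (B / ‖h 0‖) + 1) / R := by
  have hS0 : (0 : ℂ) ∉ S := fun hh => h0 ((hS 0).1 hh).1
  have hSne : ∀ ρ ∈ S, ρ ≠ 0 := fun ρ hρ h => hS0 (h ▸ hρ)
  obtain ⟨g, hg, hgz⟩ := Complex.exists_eq_prod_mul hd S (fun ρ hρ => ((hS ρ).1 hρ).1) hS0
  set P : ℂ → ℂ := fun z => ∏ ρ ∈ S, (1 - z / ρ) with hP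
  have hPd : Differentiable ℂ P := by
    apply Differentiable.fun_finsetProd
    intro i _
    fun_prop
  have hfun : h = fun z => P z * g z := funext hgz
  have hder : ∀ z, deriv h z = deriv P z * g z + P z * deriv g z := by
    intro z
    rw [hfun]
    exact deriv_fun_mul (hPd z) (hg z)
  have hg0 : g 0 = h 0 := by rw [hgz 0]; simp
  have hPzero : ∀ z, z ∈ S → P z = 0 := by
    intro z hz
    refine Finset.prod_eq_zero hz ?_
    rw [div_self (hSne z hz), sub_self]
  have hne : ∀ z ∈ ball (0 : ℂ) R, g z ≠ 0 := by
    intro z hz hz0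
    have hz1 : h z = 0 := by rw [hgz, hz0, mul_zero]
    have hzS : z ∈ S := (hS z).2 ⟨hz1, (mem_ball_zero_iff.1 hz).le⟩
    exact hs z hz1 (by rw [hder, hz0, hPzero z hzS]; ring)
  have hBpos : ‖h 0‖ ≤ B := hB 0 (by simp; positivity)
  have h0' : 0 < ‖h 0‖ := norm_pos_iff.2 h0
  have hgB : ∀ z ∈ closure (ball (0 : ℂ) (3 * R)), ‖g z‖ ≤ B := by
    intro z hz
    refine Complex.norm_le_of_forall_mem_frontier_norm_le isBounded_ball hg.diffContOnCl ?_ hz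
    intro w hw
    rw [frontier_ball _ (by positivity)] at hw
    have hw' : ‖w‖ = 3 * R := by simpa using hw
    have h1 : 1 ≤ ‖P w‖ := by
      rw [hP, norm_prod]
      refine Finset.one_le_prod fun ρ hρ => ?_
      have hρ0 := norm_pos_iff.2 (hSne ρ hρ)
      have hρR := ((hS ρ).1 hρ).2
      have h2 : 3 ≤ ‖w / ρ‖ := by
        rw [norm_div, hw', le_div_iff₀ hρ0]
        linarith
      have := norm_sub_norm_le (w / ρ) 1
      rw [norm_one, norm_sub_rev] at this
      linarith
    have h2 := hB w hw'.le
    rw [hgz, norm_mul] at h2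
    exact (le_mul_of_one_le_left (norm_nonneg _) h1).trans h2
  have hlog : 0 ≤ Real.log (B / ‖h 0‖) := Real.log_nonneg ((one_le_div h0').2 hBpos)
  have hmain := Complex.norm_logDeriv_zero_le (M := Real.log (B / ‖h 0‖) + 1) hR (by linarith)
    hg hne (by
      intro z hz
      have hz' : z ∈ closure (ball (0 : ℂ) (3 * R)) :=
        subset_closure (ball_subset_ball (by linarith) hz)
      refine (hgB z hz').trans ?_
      rw [Real.exp_add, Real.exp_log (div_pos (h0'.trans_le hBpos) h0'), hg0]
      have : B = ‖h 0‖ * (B / ‖h 0‖ * 1) := by field_simp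
      conv_lhs => rw [this]
      have h1 : (1 : ℝ) ≤ Real.exp 1 := Real.one_le_exp (by norm_num)
      have h2 : 0 ≤ B / ‖h 0‖ := (div_pos (h0'.trans_le hBpos) h0').le
      gcongr)
  have hlogP : deriv P 0 = -∑ ρ ∈ S, ρ⁻¹ := by
    have : logDeriv P 0 = ∑ ρ ∈ S, logDeriv (fun z => 1 - z / ρ) 0 := by
      rw [hP]
      rw [logDeriv_prod]
      · intro i _; simp
      · intro i _; fun_prop
    rw [logDeriv_apply] at this
    have hP0 : P 0 = 1 := by simp [hP]
    rw [hP0, div_one] at this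
    rw [this, ← Finset.sum_neg_distrib]
    refine Finset.sum_congr rfl fun ρ _ => ?_
    rw [logDeriv_apply]
    have : deriv (fun z : ℂ => 1 - z / ρ) 0 = -ρ⁻¹ := by
      rw [deriv_const_sub, deriv_div_const]; simp
    rw [this]; simp
  have hP0 : P 0 = 1 := by simp [hP]
  have : deriv h 0 / h 0 + ∑ ρ ∈ S, ρ⁻¹ = deriv g 0 / g 0 := by
    rw [hder, hlogP, hP0, ← hg0]
    have := hg0 ▸ h0
    field_simp
    ring
  rwa [this]

/-- Partial sums of the Mittag-Leffler expansion of `h' / h`, for an entire function `h` of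
subexponential growth with simple zeros. -/
theorem Complex.sum_inv_zeros_tendsto {h : ℂ → ℂ} (hd : Differentiable ℂ h)
    (hgr : SubexponentialGrowth h) (hs : ∀ z, h z = 0 → deriv h z ≠ 0) (w : ℂ) (hw : h w ≠ 0)
    {ε : ℝ} (hε : 0 < ε) :
    ∃ R₀ : ℝ, ∀ R, R₀ ≤ R → ∀ S : Finset ℂ, (∀ z, z ∈ S ↔ h z = 0 ∧ ‖z - w‖ ≤ R) →
      ‖deriv h w / h w + ∑ ρ ∈ S, (ρ - w)⁻¹‖ < ε := by
  classical
  -- On radius `3R` this growth contributes `εR / 8` to the logarithm, hence `ε / 2` after the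
  -- factor `4 / R`; the remaining `4(D + 1) / R` is below `ε / 2` for large `R`.
  obtain ⟨C, hC⟩ := hgr (ε / 24) (by positivity)
  have hw0 : 0 < ‖h w‖ := norm_pos_iff.2 hw
  have hCpos : 0 < C := by
    have := hw0.trans_le (hC w)
    exact pos_of_mul_pos_left this (Real.exp_pos _).le
  set D : ℝ := Real.log (C * Real.exp (ε / 24 * ‖w‖) / ‖h w‖) with hD
  obtain ⟨R₀, hR₀⟩ := eventually_atTop.1
    ((tendsto_id.const_mul_atTop (show 0 < ε / 8 by positivity)).eventually_gt_atTop (D + 1))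
  refine ⟨max R₀ 1, fun R hR S hS => ?_⟩
  have hR1 : 0 < R := lt_of_lt_of_le one_pos ((le_max_right _ _).trans hR)
  have hRD := hR₀ R ((le_max_left _ _).trans hR)
  have hder : ∀ z, deriv (fun z => h (z + w)) z = deriv h (z + w) := fun z =>
    deriv_comp_add_const h w z
  have key := Complex.norm_logDeriv_add_sum_inv_le (h := fun z => h (z + w)) (R := R)
    (B := C * Real.exp (ε / 24 * (3 * R + ‖w‖))) hR1
    (hd.comp (differentiable_id.add_const w)) (by simpa using hw)
    (fun z hz => by rw [hder]; exact hs _ hz)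
    (S.image (fun z => z - w)) (fun z => by
      rw [Finset.mem_image]
      constructor
      · rintro ⟨y, hy, rfl⟩
        simpa using (hS y).1 hy
      · rintro ⟨h1, h2⟩
        exact ⟨z + w, (hS _).2 ⟨h1, by simpa using h2⟩, by simp⟩)
    (fun z hz => by
      refine (hC _).trans ?_
      have := norm_add_le z w
      gcongr
      linarith)
  rw [hder, Finset.sum_image (fun x _ y _ hxy => by simpa using hxy)] at key
  simp only [zero_add] at key
  refine key.trans_lt ?_
  have : Real.log (C * Real.exp (ε / 24 * (3 * R + ‖w‖)) / ‖h w‖) = D + ε / 8 * R := by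
    have e1 : C * Real.exp (ε / 24 * (3 * R + ‖w‖)) / ‖h w‖
        = C * Real.exp (ε / 24 * ‖w‖) / ‖h w‖ * Real.exp (ε / 8 * R) := by
      have : ε / 24 * (3 * R + ‖w‖) = ε / 24 * ‖w‖ + ε / 8 * R := by ring
      rw [this, Real.exp_add]
      ring
    rw [e1, Real.log_mul (by positivity) (by positivity), Real.log_exp]
  rw [this, div_lt_iff₀ hR1]
  simp only [id] at hRD
  linarith

theorem Complex.finite_zeros_inter_closedBall {h : ℂ → ℂ} (hd : Differentiable ℂ h) {w : ℂ}
    (hw : h w ≠ 0) (c : ℂ) (R : ℝ) : {z | h z = 0 ∧ ‖z - c‖ ≤ R}.Finite := by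
  by_contra hinf
  have hsub : {z | h z = 0 ∧ ‖z - c‖ ≤ R} ⊆ closedBall c R := fun z hz => by
    simpa [dist_eq_norm] using hz.2
  obtain ⟨x, -, hx⟩ := Set.Infinite.exists_accPt_of_subset_isCompact hinf
    (isCompact_closedBall c R) hsub
  have hfr : ∃ᶠ z in 𝓝[≠] x, h z = 0 := by
    have := accPt_iff_frequently_nhdsNE.1 hx
    exact this.mono fun z hz => hz.1
  have han : AnalyticOnNhd ℂ h Set.univ := fun z _ => hd.analyticAt z
  exact hw (han.eqOn_zero_of_preconnected_of_frequently_eq_zero isPreconnected_univ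
    (Set.mem_univ x) hfr (Set.mem_univ w))

/-- Dividing out a zero preserves subexponential growth. -/
theorem SubexponentialGrowth.dslope {h : ℂ → ℂ} (hgr : SubexponentialGrowth h)
    (hd : Differentiable ℂ h) {a : ℂ} (ha : h a = 0) : SubexponentialGrowth (dslope h a) := by
  intro ε hε
  obtain ⟨C, hC⟩ := hgr ε hε
  have hcont : ContinuousOn (_root_.dslope h a) (closedBall a 1) := by
    have := (Complex.differentiableOn_dslope (f := h) (s := Set.univ) (c := a) univ_mem).2
      hd.differentiableOn
    exact this.continuousOn.mono (Set.subset_univ _)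
  obtain ⟨K, hK⟩ := (isCompact_closedBall a 1).exists_bound_of_continuousOn hcont
  have hK0 : 0 ≤ K := (norm_nonneg _).trans (hK a (mem_closedBall_self zero_le_one))
  refine ⟨C + K, fun z => ?_⟩
  have hC0 : 0 ≤ C := by
    have := (norm_nonneg _).trans (hC 0)
    simpa using this
  have h1 : 1 ≤ Real.exp (ε * ‖z‖) := Real.one_le_exp (by positivity)
  by_cases hz : z ∈ closedBall a 1
  · calc _ ≤ K := hK z hz
      _ ≤ C + K := by linarith
      _ ≤ _ := le_mul_of_one_le_right (by positivity) h1
  · have hz' : 1 ≤ ‖z - a‖ := by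
      rw [mem_closedBall, dist_eq_norm, not_le] at hz
      exact hz.le
    have e := sub_smul_dslope h a z
    rw [ha, sub_zero, smul_eq_mul] at e
    calc ‖_root_.dslope h a z‖ ≤ ‖z - a‖ * ‖_root_.dslope h a z‖ :=
          le_mul_of_one_le_left (norm_nonneg _) hz'
      _ = ‖h z‖ := by rw [← norm_mul, e]
      _ ≤ C * Real.exp (ε * ‖z‖) := hC z
      _ ≤ _ := by gcongr; linarith

/-! ### The entire function behind `J_ν` and its differential equation -/

noncomputable def besselCoeff (ν : ℝ) (m : ℕ) : ℝ :=
  (-1) ^ m / ((m.factorial : ℝ) * Real.Gamma ((m : ℝ) + ν + 1))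

/-- The entire function `∑ (-1)^m z^m / (m! Γ(m + ν + 1))`, so that
`J_ν(x) = (x / 2) ^ ν * besselEntire ν (x ^ 2 / 4)`. -/
noncomputable def besselEntire (ν : ℝ) (z : ℂ) : ℂ := ∑' m : ℕ, (besselCoeff ν m : ℂ) * z ^ m

section

variable {ν : ℝ}

/-- The series `∑ ε⁻ᵐ / Γ(m + ν + 1)` converges by the ratio test, so its terms are bounded. That
`ε` is arbitrary is what makes the growth subexponential. -/
theorem besselCoeff_abs_le (hν : -1 < ν) {ε : ℝ} (hε : 0 < ε) :
    ∃ C : ℝ, 0 < C ∧ ∀ m, |besselCoeff ν m| ≤ C * (ε ^ m / m.factorial) := by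
  have hΓ : ∀ m : ℕ, 0 < Real.Gamma ((m : ℝ) + ν + 1) := fun m =>
    Real.Gamma_pos_of_pos (by have : (0 : ℝ) ≤ m := m.cast_nonneg; linarith)
  have hsum : Summable fun m : ℕ => ε⁻¹ ^ m / Real.Gamma ((m : ℝ) + ν + 1) := by
    refine summable_of_ratio_test_tendsto_lt_one (l := 0) one_pos
      (Eventually.of_forall fun m => by have := hΓ m; positivity) ?_
    have h1 : Tendsto (fun m : ℕ => ε⁻¹ / ((m : ℝ) + (ν + 1))) atTop (𝓝 0) :=
      tendsto_const_nhds.div_atTop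
        (tendsto_atTop_add_const_right _ _ tendsto_natCast_atTop_atTop)
    refine h1.congr fun m => ?_
    have hm : 0 < (m : ℝ) + ν + 1 := by have : (0 : ℝ) ≤ m := m.cast_nonneg; linarith
    have h2 : Real.Gamma (((m + 1 : ℕ) : ℝ) + ν + 1)
        = ((m : ℝ) + ν + 1) * Real.Gamma ((m : ℝ) + ν + 1) := by
      rw [← Real.Gamma_add_one hm.ne']
      congr 1
      push_cast
      ring
    have hΓm := hΓ m
    rw [Real.norm_of_nonneg (by have := hΓ (m + 1); positivity),
      Real.norm_of_nonneg (by positivity), h2, pow_succ, ← add_assoc]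
    field_simp
  refine ⟨(∑' m : ℕ, ε⁻¹ ^ m / Real.Gamma ((m : ℝ) + ν + 1)) + 1, ?_, fun m => ?_⟩
  · have := tsum_nonneg (L := .unconditional ℕ) (g := fun m : ℕ => ε⁻¹ ^ m / Real.Gamma ((m : ℝ) + ν + 1))
      (fun m => by have := hΓ m; positivity)
    linarith
  · have h1 := hsum.le_tsum m (fun j _ => by have := hΓ j; positivity)
    have hΓm := hΓ m
    rw [besselCoeff, abs_div, abs_pow, abs_neg, abs_one, one_pow, abs_of_pos (by positivity)]
    have h2 : 1 / ((m.factorial : ℝ) * Real.Gamma ((m : ℝ) + ν + 1))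
        = (ε⁻¹ ^ m / Real.Gamma ((m : ℝ) + ν + 1)) * (ε ^ m / m.factorial) := by
      rw [inv_pow]
      field_simp
    rw [h2]
    gcongr
    linarith

theorem hasSum_besselMajorant (C ε r : ℝ) :
    HasSum (fun m : ℕ => C * (ε ^ m / m.factorial) * r ^ m) (C * Real.exp (ε * r)) := by
  have h := (NormedSpace.expSeries_div_hasSum_exp (ε * r)).mul_left C
  rw [← Real.exp_eq_exp_ℝ] at h
  have e : (fun m : ℕ => C * (ε ^ m / m.factorial) * r ^ m)
      = fun m : ℕ => C * ((ε * r) ^ m / m.factorial) := by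
    funext m
    rw [mul_pow]
    ring
  rw [e]
  exact h

theorem summable_norm_besselEntire (hν : -1 < ν) (r : ℝ) (hr : 0 ≤ r) :
    Summable fun m : ℕ => |besselCoeff ν m| * r ^ m := by
  obtain ⟨C, hC0, hC⟩ := besselCoeff_abs_le hν one_pos
  refine Summable.of_nonneg_of_le (fun m => by positivity) (fun m => ?_)
    (hasSum_besselMajorant C 1 r).summable
  gcongr
  exact hC m

theorem summable_besselEntire (hν : -1 < ν) (z : ℂ) :
    Summable fun m : ℕ => (besselCoeff ν m : ℂ) * z ^ m := by
  refine Summable.of_norm ?_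
  simpa using summable_norm_besselEntire hν ‖z‖ (norm_nonneg z)

theorem besselEntire_growth (hν : -1 < ν) : SubexponentialGrowth (besselEntire ν) := by
  intro ε hε
  obtain ⟨C, hC0, hC⟩ := besselCoeff_abs_le hν hε
  refine ⟨C, fun z => ?_⟩
  refine tsum_of_norm_bounded (hasSum_besselMajorant C ε ‖z‖) fun m => ?_
  rw [norm_mul, norm_pow, Complex.norm_real, Real.norm_eq_abs]
  gcongr
  exact hC m

/-- Coefficient form of `Λ_ν' = -Λ_{ν+1}`. -/
theorem besselCoeff_succ (m : ℕ) :
    ((m : ℝ) + 1) * besselCoeff ν (m + 1) = -besselCoeff (ν + 1) m := by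
  rw [besselCoeff, besselCoeff, Nat.factorial_succ]
  have : ((m + 1 : ℕ) : ℝ) + ν + 1 = (m : ℝ) + (ν + 1) + 1 := by push_cast; ring
  rw [this, pow_succ]
  push_cast
  have h1 : (m : ℝ) + 1 ≠ 0 := by positivity
  have h2 : (m.factorial : ℝ) ≠ 0 := by positivity
  rw [mul_assoc ((m : ℝ) + 1), mul_div_assoc', mul_div_mul_left _ _ h1]
  ring

theorem besselCoeff_recurrence (hν : -1 < ν) (m : ℕ) :
    besselCoeff ν m = ((m : ℝ) + ν + 1) * besselCoeff (ν + 1) m := by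
  have hm : 0 < (m : ℝ) + ν + 1 := by have : (0 : ℝ) ≤ m := m.cast_nonneg; linarith
  have hΓ := Real.Gamma_pos_of_pos hm
  rw [besselCoeff, besselCoeff, ← add_assoc, Real.Gamma_add_one hm.ne']
  field_simp

theorem hasDerivAt_besselEntire (hν : -1 < ν) (z : ℂ) :
    HasDerivAt (besselEntire ν) (-besselEntire (ν + 1) z) z := by
  set r := ‖z‖ + 1 with hr
  have hz : z ∈ ball (0 : ℂ) r := by simp [hr]
  have hu := summable_norm_besselEntire hν r (by positivity)
  have hterm : ∀ m : ℕ, DifferentiableOn ℂ (fun z : ℂ => (besselCoeff ν m : ℂ) * z ^ m)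
      (ball 0 r) := fun m => by fun_prop
  have hbound : ∀ (m : ℕ) (w : ℂ), w ∈ ball (0 : ℂ) r →
      ‖(besselCoeff ν m : ℂ) * w ^ m‖ ≤ |besselCoeff ν m| * r ^ m := by
    intro m w hw
    rw [norm_mul, norm_pow, Complex.norm_real, Real.norm_eq_abs]
    have := (mem_ball_zero_iff.1 hw).le
    gcongr
  have hd := Complex.differentiableOn_tsum_of_summable_norm hu hterm isOpen_ball hbound
  have hdz : DifferentiableAt ℂ (besselEntire ν) z :=
    (hd z hz).differentiableAt (isOpen_ball.mem_nhds hz)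
  have hs := Complex.hasSum_deriv_of_summable_norm hu hterm isOpen_ball hbound hz
  have hval : deriv (besselEntire ν) z = -besselEntire (ν + 1) z := by
    have h1 : deriv (besselEntire ν) z
        = ∑' m : ℕ, deriv (fun w : ℂ => (besselCoeff ν m : ℂ) * w ^ m) z := hs.tsum_eq.symm
    have h2 : ∀ m : ℕ, deriv (fun w : ℂ => (besselCoeff ν m : ℂ) * w ^ m) z
        = (besselCoeff ν m : ℂ) * (m * z ^ (m - 1)) := fun m => by
      rw [deriv_const_mul _ (by fun_prop)]
      simp
    rw [h1, hs.summable.tsum_eq_zero_add, h2 0]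
    simp only [CharP.cast_eq_zero, zero_mul, mul_zero, zero_add]
    rw [besselEntire, ← tsum_neg]
    refine tsum_congr fun m => ?_
    rw [h2, Nat.add_sub_cancel, ← neg_mul, ← Complex.ofReal_neg, ← besselCoeff_succ]
    push_cast
    ring
  rw [← hval]
  exact hdz.hasDerivAt

theorem differentiable_besselEntire (hν : -1 < ν) : Differentiable ℂ (besselEntire ν) :=
  fun z => (hasDerivAt_besselEntire hν z).differentiableAt

theorem deriv_besselEntire (hν : -1 < ν) (z : ℂ) :
    deriv (besselEntire ν) z = -besselEntire (ν + 1) z :=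
  (hasDerivAt_besselEntire hν z).deriv

/-- The Bessel differential equation, as a three-term recurrence in the order. -/
theorem besselEntire_recurrence (hν : -1 < ν) (z : ℂ) :
    z * besselEntire (ν + 1 + 1) z - (ν + 1) * besselEntire (ν + 1) z + besselEntire ν z = 0 := by
  have hν1 : -1 < ν + 1 := by linarith
  have hν2 : -1 < ν + 1 + 1 := by linarith
  have s0 := summable_besselEntire hν z
  have s1 := summable_besselEntire hν1 z
  have s2 := summable_besselEntire hν2 z
  rw [besselEntire, besselEntire, besselEntire, s0.tsum_eq_zero_add, s1.tsum_eq_zero_add,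
    ← tsum_mul_left, mul_add, ← tsum_mul_left]
  have s0' := (summable_nat_add_iff 1).2 s0
  have s1' := ((summable_nat_add_iff 1).2 s1).mul_left ((ν : ℂ) + 1)
  have s2' := s2.mul_left z
  have key : ∑' m : ℕ, z * ((besselCoeff (ν + 1 + 1) m : ℂ) * z ^ m)
      = (∑' m : ℕ, ((ν : ℂ) + 1) * ((besselCoeff (ν + 1) (m + 1) : ℂ) * z ^ (m + 1)))
        - ∑' m : ℕ, (besselCoeff ν (m + 1) : ℂ) * z ^ (m + 1) := by
    rw [← s1'.tsum_sub s0']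
    refine tsum_congr fun m => ?_
    have h1 := besselCoeff_succ (ν := ν + 1) m
    have h2 := besselCoeff_recurrence hν (m + 1)
    have h3 : besselCoeff (ν + 1 + 1) m = -(((m : ℝ) + 1) * besselCoeff (ν + 1) (m + 1)) := by
      linarith
    rw [h3, h2]
    push_cast
    ring
  have h0 := besselCoeff_recurrence hν 0
  rw [key, h0]
  push_cast
  ring

theorem besselEntire_zero (hν : -1 < ν) : besselEntire ν 0 ≠ 0 := by
  have : besselEntire ν 0 = besselCoeff ν 0 := by
    rw [besselEntire, tsum_eq_single 0 (fun m hm => by simp [hm])]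
    simp
  rw [this, besselCoeff]
  have hΓ := Real.Gamma_pos_of_pos (show 0 < ((0 : ℕ) : ℝ) + ν + 1 by simp; linarith)
  refine Complex.ofReal_ne_zero.2 (div_pos ?_ (by positivity)).ne'
  simp

theorem besselEntire_ofReal (x : ℝ) :
    besselEntire ν x = ((∑' m : ℕ, besselCoeff ν m * x ^ m : ℝ) : ℂ) := by
  rw [besselEntire, Complex.ofReal_tsum]
  push_cast
  rfl

/-- For `x ≤ 0` the signs cancel: every term is nonnegative and the constant term is positive. -/
theorem besselEntire_ne_zero_of_nonpos (hν : -1 < ν) {x : ℝ} (hx : x ≤ 0) :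
    besselEntire ν x ≠ 0 := by
  rw [besselEntire_ofReal]
  norm_cast
  have hterm : ∀ m : ℕ, besselCoeff ν m * x ^ m
      = (-x) ^ m / ((m.factorial : ℝ) * Real.Gamma ((m : ℝ) + ν + 1)) := fun m => by
    rw [besselCoeff, neg_pow x m]
    ring
  have hΓ : ∀ m : ℕ, 0 < Real.Gamma ((m : ℝ) + ν + 1) := fun m =>
    Real.Gamma_pos_of_pos (by have : (0 : ℝ) ≤ m := m.cast_nonneg; linarith)
  have hx' : 0 ≤ -x := by linarith
  have hs : Summable fun m : ℕ => besselCoeff ν m * x ^ m := by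
    have := (summable_besselEntire hν (x : ℂ))
    exact_mod_cast this
  refine (hs.tsum_pos (fun m => ?_) 0 ?_).ne'
  · rw [hterm]; have := hΓ m; positivity
  · rw [hterm]; have := hΓ 0; positivity

/-! ### Reality, positivity and simplicity of the zeros -/

/-- `V / s` is monotone with equal end values, hence constant. This serves both the reality proof
(`s = -Im l`) and the simplicity proof (`s = 1`). -/
theorem eq_zero_of_hasDerivAt_nonneg {V φ : ℝ → ℝ} {b s : ℝ} (hs : s ≠ 0)
    (hV : ContinuousOn V (Set.Icc 0 b)) (hd : ∀ t ∈ Set.Ioo 0 b, HasDerivAt V (s * φ t) t)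
    (hφ : ∀ t ∈ Set.Ioo 0 b, 0 ≤ φ t) (hVb : V 0 = V b) : ∀ t ∈ Set.Ioo 0 b, φ t = 0 := by
  intro t ht
  have hb : 0 < b := ht.1.trans ht.2
  set W : ℝ → ℝ := fun t => s⁻¹ * V t
  have hWd : ∀ t ∈ Set.Ioo 0 b, HasDerivAt W (φ t) t := fun t ht => by
    refine ((hd t ht).const_mul s⁻¹).congr_deriv ?_
    field_simp
  have hmono : MonotoneOn W (Set.Icc 0 b) := by
    refine monotoneOn_of_deriv_nonneg (convex_Icc 0 b) (hV.const_smul s⁻¹) ?_ ?_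
    · rw [interior_Icc]
      exact fun t ht => (hWd t ht).differentiableAt.differentiableWithinAt
    · rw [interior_Icc]
      intro t ht
      rw [(hWd t ht).deriv]
      exact hφ t ht
  have hconst : ∀ y ∈ Set.Icc 0 b, W y = W 0 := by
    intro y hy
    refine le_antisymm ?_ (hmono ⟨le_rfl, hb.le⟩ hy hy.1)
    have := hmono hy ⟨hb.le, le_rfl⟩ hy.2
    simpa [W, hVb] using this
  have hev : W =ᶠ[𝓝 t] fun _ => W 0 :=
    Filter.eventually_of_mem (Icc_mem_nhds ht.1 ht.2) hconst
  exact (hWd t ht).unique ((hasDerivAt_const t (W 0)).congr_of_eventuallyEq hev)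

theorem eq_zero_of_forall_Ioo {u : ℝ → ℂ} (hu : Continuous u) {b : ℝ} (hb : 0 < b)
    (h : ∀ t ∈ Set.Ioo 0 b, u t = 0) : u 0 = 0 := by
  have hc : IsClosed {t | u t = 0} := isClosed_eq hu continuous_const
  have : closure (Set.Ioo 0 b) ⊆ {t | u t = 0} := hc.closure_subset_iff.2 h
  rw [closure_Ioo hb.ne] at this
  exact this ⟨le_rfl, hb.le⟩

/-- Sturm–Liouville argument: `u(t) = Λ(lt)` satisfies `(t^(ν+1) u')' = -l t^ν u`, so `V = t^(ν+1)
Im(ū u')` has derivative `-Im(l) t^ν |u|²`. It vanishes at `0` by the weight and at `1` because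
`Λ(l) = 0`. If `Im l ≠ 0`, then `u = 0` on `(0, 1)`, against `Λ(0) ≠ 0`. -/
theorem besselEntire_zero_im (hν : -1 < ν) {l : ℂ} (hl : besselEntire ν l = 0) : l.im = 0 := by
  by_contra him
  have hν1 : -1 < ν + 1 := by linarith
  set u : ℝ → ℂ := fun t => besselEntire ν (l * t) with hu
  set p : ℝ → ℂ := fun t => -l * besselEntire (ν + 1) (l * t) with hp
  have hlin : ∀ t : ℝ, HasDerivAt (fun t : ℝ => l * (t : ℂ)) l t := fun t => by
    simpa using (Complex.ofRealCLM.hasDerivAt (x := t)).const_mul l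
  have hud : ∀ t : ℝ, HasDerivAt u (p t) t := fun t => by
    refine ((hasDerivAt_besselEntire hν (l * t)).comp t (hlin t)).congr_deriv ?_
    simp only [hp]; ring
  have hpd : ∀ t : ℝ, HasDerivAt p (l ^ 2 * besselEntire (ν + 1 + 1) (l * t)) t := fun t => by
    refine (((hasDerivAt_besselEntire hν1 (l * t)).comp t (hlin t)).const_mul (-l)).congr_deriv ?_
    ring
  have hode : ∀ t : ℝ, (t : ℂ) * (l ^ 2 * besselEntire (ν + 1 + 1) (l * t))
      = -((ν : ℂ) + 1) * p t - l * u t := fun t => by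
    have := besselEntire_recurrence hν (l * t)
    simp only [hp, hu]
    linear_combination l * this
  have hre : ∀ {g : ℝ → ℂ} {g' : ℂ} {t : ℝ}, HasDerivAt g g' t →
      HasDerivAt (fun t => (g t).re) g'.re t := fun {g g' t} h =>
    (Complex.reCLM.hasFDerivAt (x := g t)).comp_hasDerivAt t h
  have hima : ∀ {g : ℝ → ℂ} {g' : ℂ} {t : ℝ}, HasDerivAt g g' t →
      HasDerivAt (fun t => (g t).im) g'.im t := fun {g g' t} h =>
    (Complex.imCLM.hasFDerivAt (x := g t)).comp_hasDerivAt t h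
  have huc : Continuous u := continuous_iff_continuousAt.2 fun t => (hud t).continuousAt
  have hpc : Continuous p := continuous_iff_continuousAt.2 fun t => (hpd t).continuousAt
  set V : ℝ → ℝ := fun t => t ^ (ν + 1) * ((u t).re * (p t).im - (u t).im * (p t).re) with hV
  have key := eq_zero_of_hasDerivAt_nonneg (V := V) (b := 1) (s := -l.im)
    (φ := fun t => t ^ ν * ((u t).re ^ 2 + (u t).im ^ 2)) (neg_ne_zero.2 him) (by
      have h1 : Continuous fun t : ℝ => t ^ (ν + 1) :=
        Real.continuous_rpow_const (by linarith)
      fun_prop) (by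
      intro t ht
      have ht0 : 0 < t := ht.1
      have h1 := Real.hasDerivAt_rpow_const (x := t) (p := ν + 1) (Or.inl ht0.ne')
      have h2 := h1.mul (((hre (hud t)).mul (hima (hpd t))).sub ((hima (hud t)).mul (hre (hpd t))))
      refine h2.congr_deriv ?_
      have e := hode t
      generalize l ^ 2 * besselEntire (ν + 1 + 1) (l * t) = q at e ⊢
      have e1 := congrArg Complex.re e
      have e2 := congrArg Complex.im e
      rw [Complex.re_ofReal_mul] at e1
      rw [Complex.im_ofReal_mul] at e2
      simp only [Complex.sub_re, Complex.sub_im, Complex.mul_re, Complex.mul_im, Complex.neg_re,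
        Complex.neg_im, Complex.add_re, Complex.add_im, Complex.ofReal_re, Complex.ofReal_im,
        Complex.one_re, Complex.one_im] at e1 e2
      have e3 : t ^ (ν + 1) = t ^ ν * t := Real.rpow_add_one ht0.ne' ν
      simp only [add_sub_cancel_right, Pi.mul_apply, Pi.sub_apply]
      rw [e3]
      linear_combination t ^ ν * (u t).re * e2 - t ^ ν * (u t).im * e1)
    (fun t ht => by have := ht.1; positivity) (by
      have h1 : u 1 = 0 := by simpa [hu] using hl
      simp only [hV, h1]
      rw [Real.zero_rpow (by linarith)]
      simp)
  have hzero : ∀ t ∈ Set.Ioo (0 : ℝ) 1, u t = 0 := by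
    intro t ht
    have h1 := key t ht
    have h2 : (t : ℝ) ^ ν ≠ 0 := (Real.rpow_pos_of_pos ht.1 ν).ne'
    have h3 := (mul_eq_zero.1 h1).resolve_left h2
    refine Complex.ext ?_ ?_
    · simp only [Complex.zero_re]; nlinarith [sq_nonneg (u t).re, sq_nonneg (u t).im]
    · simp only [Complex.zero_im]; nlinarith [sq_nonneg (u t).re, sq_nonneg (u t).im]
  have := eq_zero_of_forall_Ioo huc one_pos hzero
  exact besselEntire_zero hν (by simpa [hu] using this)

theorem besselEntire_zero_re (hν : -1 < ν) {l : ℂ} (hl : besselEntire ν l = 0) : 0 < l.re := by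
  by_contra hre
  refine besselEntire_ne_zero_of_nonpos hν (not_lt.1 hre) ?_
  have : ((l.re : ℝ) : ℂ) = l := Complex.ext (by simp) (by simp [besselEntire_zero_im hν hl])
  rw [this, hl]

/-- The differential equation makes `t^ν u²` the derivative of the `F` below, a quadratic form in
`u` and `u'`. At a double zero `x` one has `F(0) = F(x) = 0`, so `u` vanishes on `(0, x)`, against
`Λ(0) ≠ 0`. -/
theorem besselEntire_simple (hν : -1 < ν) {l : ℂ} (hl : besselEntire ν l = 0) :
    deriv (besselEntire ν) l ≠ 0 := by
  intro hl'
  have hν1 : -1 < ν + 1 := by linarith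
  obtain ⟨x, rfl⟩ : ∃ x : ℝ, (x : ℂ) = l :=
    ⟨l.re, Complex.ext (by simp) (by simp [besselEntire_zero_im hν hl])⟩
  have hx : 0 < x := by simpa using besselEntire_zero_re hν hl
  set u : ℝ → ℝ := fun t => (besselEntire ν t).re with hu
  set p : ℝ → ℝ := fun t => (-besselEntire (ν + 1) t).re with hp
  have hud : ∀ t : ℝ, HasDerivAt u (p t) t := fun t =>
    (hasDerivAt_besselEntire hν (t : ℂ)).real_of_complex
  have hpd : ∀ t : ℝ, HasDerivAt p (besselEntire (ν + 1 + 1) t).re t := fun t => by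
    have := (hasDerivAt_besselEntire hν1 (t : ℂ)).neg.real_of_complex
    simpa [hp] using this
  have hode : ∀ t : ℝ, t * (besselEntire (ν + 1 + 1) t).re + (ν + 1) * p t + u t = 0 := fun t => by
    have := congrArg Complex.re (besselEntire_recurrence hν (t : ℂ))
    have e : ((ν : ℂ) + 1) = ((ν + 1 : ℝ) : ℂ) := by push_cast; ring
    rw [e, Complex.add_re, Complex.sub_re, Complex.re_ofReal_mul, Complex.re_ofReal_mul] at this
    simp only [hp, hu, Complex.neg_re]
    rw [Complex.zero_re] at this
    linarith
  have huc : Continuous u := continuous_iff_continuousAt.2 fun t => (hud t).continuousAt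
  have hpc : Continuous p := continuous_iff_continuousAt.2 fun t => (hpd t).continuousAt
  set F : ℝ → ℝ := fun t => t ^ (ν + 1) * (t * p t ^ 2 + ν * (u t * p t) + u t ^ 2) with hF
  have key := eq_zero_of_hasDerivAt_nonneg (V := F) (b := x) (s := 1)
    (φ := fun t => t ^ ν * u t ^ 2) one_ne_zero (by
      have h1 : Continuous fun t : ℝ => t ^ (ν + 1) :=
        Real.continuous_rpow_const (by linarith)
      fun_prop) (by
      intro t ht
      have ht0 : 0 < t := ht.1
      have h1 := Real.hasDerivAt_rpow_const (x := t) (p := ν + 1) (Or.inl ht0.ne')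
      have h2 := h1.mul ((((hasDerivAt_id t).mul ((hpd t).pow 2)).add
        (((hud t).mul (hpd t)).const_mul ν)).add ((hud t).pow 2))
      refine h2.congr_deriv ?_
      have e3 : t ^ (ν + 1) = t ^ ν * t := Real.rpow_add_one ht0.ne' ν
      simp only [add_sub_cancel_right, Pi.mul_apply, Pi.add_apply, Pi.pow_apply, id]
      rw [e3]
      push_cast
      linear_combination t ^ ν * (2 * t * p t + ν * u t) * hode t)
    (fun t ht => by have := ht.1; positivity) (by
      have h1 : u x = 0 := by simp [hu, hl]
      have h2 : p x = 0 := by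
        rw [deriv_besselEntire hν] at hl'
        simp only [hp, hl', Complex.zero_re]
      simp only [hF, h1, h2]
      rw [Real.zero_rpow (by linarith)]
      simp)
  have := eq_zero_of_forall_Ioo (u := fun t : ℝ => besselEntire ν t)
    ((differentiable_besselEntire hν).continuous.comp Complex.continuous_ofReal) hx (by
      intro t ht
      have h1 := key t ht
      have h2 : (t : ℝ) ^ ν ≠ 0 := (Real.rpow_pos_of_pos ht.1 ν).ne'
      have h3 : u t = 0 := by simpa using (mul_eq_zero.1 h1).resolve_left h2
      rw [besselEntire_ofReal] at *
      simpa [hu, besselEntire_ofReal] using h3)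
  exact besselEntire_zero hν (by simpa using this)

end

/-! ### Infinitude of the zeros -/

/-- The expansion of `h'/h` is then a finite sum, equal to the logarithmic derivative of the product
over the zeros. So the cofactor `g` has `g' = 0` off the zeros, and everywhere by density. -/
theorem Complex.exists_polynomial_of_finite_zeros {h : ℂ → ℂ} (hd : Differentiable ℂ h)
    (hgr : SubexponentialGrowth h) (hs : ∀ z, h z = 0 → deriv h z ≠ 0) (h0 : h 0 ≠ 0)
    (hfin : {z | h z = 0}.Finite) : ∃ p : Polynomial ℂ, ∀ z, h z = p.eval z := by
  set S : Finset ℂ := hfin.toFinset with hSdef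
  have hS : ∀ z, z ∈ S ↔ h z = 0 := fun z => by simp [hSdef]
  have hS0 : (0 : ℂ) ∉ S := fun hh => h0 ((hS 0).1 hh)
  have hSne : ∀ ρ ∈ S, ρ ≠ 0 := fun ρ hρ h => hS0 (h ▸ hρ)
  obtain ⟨g, hg, hgz⟩ := Complex.exists_eq_prod_mul hd S (fun ρ hρ => (hS ρ).1 hρ) hS0
  have hlog : ∀ w, h w ≠ 0 → logDeriv h w = -∑ ρ ∈ S, (ρ - w)⁻¹ := by
    intro w hw
    rw [eq_neg_iff_add_eq_zero, ← norm_le_zero_iff, logDeriv_apply]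
    refine le_of_forall_pos_lt_add fun ε hε => ?_
    rw [zero_add]
    obtain ⟨R₀, hR₀⟩ := Complex.sum_inv_zeros_tendsto hd hgr hs w hw hε
    -- The sum of all distances `‖ρ - w‖` is a radius that captures every zero.
    refine hR₀ (max R₀ (∑ ρ ∈ S, ‖ρ - w‖)) (le_max_left _ _) S fun z => ?_
    rw [hS]
    refine ⟨fun hz => ⟨hz, le_max_of_le_right ?_⟩, fun hz => hz.1⟩
    exact Finset.single_le_sum (f := fun ρ => ‖ρ - w‖) (fun _ _ => norm_nonneg _) ((hS z).2 hz)
  have hg' : ∀ w ∈ {z | h z = 0}ᶜ, deriv g w = 0 := by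
    intro w hw
    have hfac : ∀ ρ ∈ S, 1 - w / ρ ≠ 0 := fun ρ hρ h1 => by
      have := hSne ρ hρ
      have e : w = ρ := by field_simp at h1; linear_combination -h1
      exact hw (e ▸ (hS ρ).1 hρ)
    have hgw : g w ≠ 0 := fun h1 => hw (by simp [hgz, h1])
    have h1 := hlog w hw
    have hfun : h = fun z => (∏ ρ ∈ S, (1 - z / ρ)) * g z := funext hgz
    rw [hfun, logDeriv_mul (f := fun z => ∏ ρ ∈ S, (1 - z / ρ)) w (Finset.prod_ne_zero_iff.2 hfac)
      hgw (DifferentiableAt.fun_finsetProd fun _ _ => by fun_prop) (hg w),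
      logDeriv_prod (f := fun ρ z => 1 - z / ρ) hfac (fun _ _ => by fun_prop)] at h1
    have h2 : ∀ ρ ∈ S, logDeriv (fun z => 1 - z / ρ) w = -(ρ - w)⁻¹ := fun ρ hρ => by
      have hd : deriv (fun z : ℂ => 1 - z / ρ) w = -ρ⁻¹ := by
        rw [deriv_const_sub, deriv_div_const]; simp
      have h3 := hSne ρ hρ
      have h4 : ρ - w ≠ 0 := fun h5 => hw (by
        rw [← sub_eq_zero.1 h5]; exact (hS ρ).1 hρ)
      have h5 := hfac ρ hρ
      rw [logDeriv_apply, hd, show 1 - w / ρ = (ρ - w) / ρ by field_simp]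
      field_simp
    rw [Finset.sum_congr rfl h2, Finset.sum_neg_distrib, add_eq_left, logDeriv_apply,
      div_eq_zero_iff] at h1
    exact h1.resolve_right hgw
  have hg'' : deriv g = fun _ => 0 :=
    Continuous.ext_on (hfin.countable.dense_compl ℂ) (hg.contDiff.continuous_deriv (n := 1) le_rfl)
      continuous_const hg'
  have hconst : ∀ z, g z = g 0 := fun z =>
    is_const_of_deriv_eq_zero hg (fun x => congrFun hg'' x) z 0
  refine ⟨Polynomial.C (g 0) * ∏ ρ ∈ S, (1 - Polynomial.C ρ⁻¹ * Polynomial.X), fun z => ?_⟩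
  rw [hgz, hconst, Polynomial.eval_mul, Polynomial.eval_prod, mul_comm]
  simp [div_eq_inv_mul]

/-- Otherwise `Λ` is a polynomial `p` with `Xp'' + (ν+1)p' + p = 0`. In degree `deg p` only `p`
contributes, so its leading coefficient is zero. -/
theorem besselEntire_zeros_infinite {ν : ℝ} (hν : -1 < ν) : {z | besselEntire ν z = 0}.Infinite := by
  intro hfin
  have hν1 : -1 < ν + 1 := by linarith
  obtain ⟨p, hp⟩ := Complex.exists_polynomial_of_finite_zeros (differentiable_besselEntire hν)
    (besselEntire_growth hν) (fun z => besselEntire_simple hν) (besselEntire_zero hν) hfin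
  have hp1 : ∀ z, besselEntire (ν + 1) z = -p.derivative.eval z := fun z => by
    rw [eq_neg_iff_add_eq_zero, ← Polynomial.deriv, ← funext hp, deriv_besselEntire hν]
    ring
  have hp2 : ∀ z, besselEntire (ν + 1 + 1) z = p.derivative.derivative.eval z := fun z => by
    have := deriv_besselEntire hν1 z
    rw [funext hp1, deriv.fun_neg, Polynomial.deriv] at this
    linear_combination this
  have hpoly : Polynomial.X * p.derivative.derivative + Polynomial.C ((ν : ℂ) + 1) * p.derivative
      + p = 0 := by
    refine Polynomial.funext fun z => ?_
    have := besselEntire_recurrence hν z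
    rw [hp, hp1, hp2] at this
    simp only [Polynomial.eval_add, Polynomial.eval_mul, Polynomial.eval_X, Polynomial.eval_C,
      Polynomial.eval_zero]
    linear_combination this
  have hlead := congrArg (fun q : Polynomial ℂ => q.coeff p.natDegree) hpoly
  have h1 : p.derivative.coeff p.natDegree = 0 := by
    rw [Polynomial.coeff_derivative, Polynomial.coeff_eq_zero_of_natDegree_lt (Nat.lt_succ_self _),
      zero_mul]
  have h2 : (Polynomial.X * p.derivative.derivative).coeff p.natDegree = 0 := by
    rcases hn : p.natDegree with _ | n
    · simp
    · rw [Polynomial.coeff_X_mul, Polynomial.coeff_derivative, ← hn, h1, zero_mul]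
  simp only [Polynomial.coeff_add, Polynomial.coeff_C_mul, h1, h2, Polynomial.coeff_zero, mul_zero,
    zero_add] at hlead
  have hp0 : p = 0 := Polynomial.leadingCoeff_eq_zero.1 hlead
  exact besselEntire_zero hν (by simp [hp, hp0])

/-! ### The sum over the other zeros -/

/-- Upgrades convergence along one exhaustion to unconditional convergence: `∑ |f|` exceeds `∑ f` by
at most twice the finite sum of `|f|` over the negative terms. -/
theorem hasSum_of_tendsto_of_finite_neg {ι : Type*} {f : ι → ℝ} {S : ℕ → Finset ι} {L : ℝ}
    (hmono : Monotone S) (hcov : ∀ i, ∃ n, i ∈ S n) (hneg : {i | f i < 0}.Finite)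
    (hlim : Tendsto (fun n => ∑ i ∈ S n, f i) atTop (𝓝 L)) : HasSum f L := by
  classical
  have hS : Tendsto S atTop atTop := tendsto_atTop_finset_of_monotone hmono hcov
  have hsum : Summable fun i => |f i| := by
    refine summable_of_sum_le (c := L + 1 + 2 * ∑ i ∈ hneg.toFinset, |f i|)
      (fun i => abs_nonneg _) fun T => ?_
    obtain ⟨n, hn1, hn2⟩ := ((hS.eventually_ge_atTop (T ∪ hneg.toFinset)).and
      (hlim.eventually (gt_mem_nhds (lt_add_one L)))).exists
    calc ∑ i ∈ T, |f i| ≤ ∑ i ∈ S n, |f i| :=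
          Finset.sum_le_sum_of_subset_of_nonneg (Finset.subset_union_left.trans hn1)
            fun _ _ _ => abs_nonneg _
      _ = ∑ i ∈ S n, f i + ∑ i ∈ S n, (|f i| - f i) := by
          rw [← Finset.sum_add_distrib]; exact Finset.sum_congr rfl fun _ _ => by ring
      _ = ∑ i ∈ S n, f i + ∑ i ∈ hneg.toFinset, (|f i| - f i) := by
          rw [Finset.sum_subset (Finset.subset_union_right.trans hn1)]
          intro i _ hi
          have : 0 ≤ f i := by simpa using hi
          rw [abs_of_nonneg this, sub_self]
      _ ≤ (L + 1) + ∑ i ∈ hneg.toFinset, 2 * |f i| := by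
          refine add_le_add hn2.le (Finset.sum_le_sum fun i _ => ?_)
          linarith [neg_abs_le (f i)]
      _ = _ := by rw [Finset.mul_sum]
  have h := hsum.of_abs.hasSum
  exact (tendsto_nhds_unique (h.comp hS) hlim) ▸ h

theorem hasSum_inv_sub_besselEntire_zeros {ν : ℝ} (hν : -1 < ν) {x : ℝ}
    (hx : besselEntire ν x = 0) :
    HasSum (fun y : {y : ℝ // besselEntire ν y = 0 ∧ y ≠ x} => ((y : ℝ) - x)⁻¹)
      ((ν + 1) / (2 * x)) := by
  classical
  have hν1 : -1 < ν + 1 := by linarith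
  have hx0 : 0 < x := by simpa using besselEntire_zero_re hν hx
  have hd := differentiable_besselEntire hν
  set h : ℂ → ℂ := dslope (besselEntire ν) x with hh
  have hhd : Differentiable ℂ h := differentiableOn_univ.1
    ((Complex.differentiableOn_dslope univ_mem).2 hd.differentiableOn)
  have hmul : ∀ z, besselEntire ν z = (z - x) * h z := fun z => by
    have := sub_smul_dslope (besselEntire ν) x z
    rw [hx, sub_zero, smul_eq_mul] at this
    exact this.symm
  have hder : ∀ z, deriv (besselEntire ν) z = h z + (z - x) * deriv h z := fun z => by
    have h1 := ((hasDerivAt_id z).sub_const (x : ℂ)).mul (hhd z).hasDerivAt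
    have h2 : besselEntire ν = fun z => (z - x) * h z := funext hmul
    rw [h2]
    refine (HasDerivAt.deriv (f := fun z => (z - x) * h z) h1).trans ?_
    simp
  have hhx : h x = deriv (besselEntire ν) x := by rw [hder]; simp
  have hhx0 : h x ≠ 0 := hhx ▸ besselEntire_simple hν hx
  have hzero : ∀ z, h z = 0 ↔ besselEntire ν z = 0 ∧ z ≠ x := fun z => by
    constructor
    · intro hz
      exact ⟨by rw [hmul, hz, mul_zero], fun hzx => hhx0 (hzx ▸ hz)⟩
    · rintro ⟨h1, h2⟩
      rw [hmul] at h1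
      exact (mul_eq_zero.1 h1).resolve_left (sub_ne_zero.2 h2)
  have hsimple : ∀ z, h z = 0 → deriv h z ≠ 0 := fun z hz h1 =>
    besselEntire_simple hν ((hzero z).1 hz).1 (by rw [hder, hz, h1]; ring)
  -- Differentiating `Λ' = h + (z - x)h'` at `x` gives `Λ''(x) = 2h'(x)`, while `Λ'(x) = h(x)`; the
  -- differential equation at `x` gives the ratio.
  have hval : deriv h x / h x = -(((ν + 1) / (2 * x) : ℝ) : ℂ) := by
    have hh'd : Differentiable ℂ (deriv h) :=
      (hhd.contDiff (n := 2)).differentiable_deriv_two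
    have h1 : HasDerivAt (fun z => h z + (z - x) * deriv h z)
        (deriv h x + (1 * deriv h x + ((x : ℂ) - x) * deriv (deriv h) x)) x :=
      (hhd x).hasDerivAt.add (((hasDerivAt_id (x : ℂ)).sub_const (x : ℂ)).mul (hh'd x).hasDerivAt)
    have h2 : HasDerivAt (fun z => h z + (z - x) * deriv h z) (besselEntire (ν + 1 + 1) x) x := by
      rw [← funext hder, funext (deriv_besselEntire hν)]
      simpa using (hasDerivAt_besselEntire hν1 (x : ℂ)).fun_neg
    have h3 := h1.unique h2
    have h4 := besselEntire_recurrence hν (x : ℂ)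
    have h5 : besselEntire (ν + 1) x = -h x := by rw [hhx, deriv_besselEntire hν]; ring
    rw [hx, h5, ← h3] at h4
    have hxc : (x : ℂ) ≠ 0 := by exact_mod_cast hx0.ne'
    push_cast
    field_simp
    linear_combination h4
  have hfin : ∀ R : ℝ, {y : {y : ℝ // besselEntire ν y = 0 ∧ y ≠ x} | |(y : ℝ) - x| ≤ R}.Finite := by
    intro R
    have := Complex.finite_zeros_inter_closedBall hhd hhx0 x R
    refine (this.preimage (f := fun y : {y : ℝ // besselEntire ν y = 0 ∧ y ≠ x} => ((y : ℝ) : ℂ))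
      (fun a _ b _ hab => Subtype.ext (Complex.ofReal_injective hab))).subset fun y hy => ?_
    refine ⟨(hzero _).2 ⟨y.2.1, fun h1 => y.2.2 (Complex.ofReal_injective h1)⟩, ?_⟩
    rw [← Complex.ofReal_sub, Complex.norm_real]
    exact hy
  refine hasSum_of_tendsto_of_finite_neg (S := fun n : ℕ => (hfin n).toFinset) ?_ ?_ ?_ ?_
  · intro m n hmn y hy
    simp only [Set.Finite.mem_toFinset, Set.mem_ofPred_eq] at hy ⊢
    exact hy.trans (by exact_mod_cast hmn)
  · intro y
    obtain ⟨n, hn⟩ := exists_nat_ge |(y : ℝ) - x|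
    exact ⟨n, by simpa using hn⟩
  -- A negative term has `0 < y < x`, since all zeros are positive.
  · refine (hfin x).subset fun y hy => ?_
    have h1 : (y : ℝ) - x < 0 := inv_lt_zero.1 hy
    have h2 : 0 < (y : ℝ) := by simpa using besselEntire_zero_re hν y.2.1
    show |(y : ℝ) - x| ≤ x
    rw [abs_of_neg h1]
    linarith
  · rw [Metric.tendsto_atTop]
    intro ε hε
    obtain ⟨R₀, hR₀⟩ := Complex.sum_inv_zeros_tendsto hhd
      ((besselEntire_growth hν).dslope hd hx) hsimple x hhx0 hε
    obtain ⟨N, hN⟩ := exists_nat_ge R₀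
    refine ⟨N, fun n hn => ?_⟩
    have h1 := hR₀ n (hN.trans (by exact_mod_cast hn))
      ((hfin n).toFinset.image fun y : {y : ℝ // besselEntire ν y = 0 ∧ y ≠ x} =>
        ((y : ℝ) : ℂ)) (fun z => by
        rw [hzero, Finset.mem_image]
        constructor
        · rintro ⟨y, hy, rfl⟩
          refine ⟨⟨y.2.1, fun h1 => y.2.2 (Complex.ofReal_injective h1)⟩, ?_⟩
          rw [← Complex.ofReal_sub, Complex.norm_real]
          simpa using hy
        · rintro ⟨⟨hz, hzx⟩, hzn⟩
          have hzr : ((z.re : ℝ) : ℂ) = z :=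
            Complex.ext (by simp) (by simp [besselEntire_zero_im hν hz])
          refine ⟨⟨z.re, by rwa [hzr], fun h1 => hzx (by rw [← hzr, h1])⟩, ?_, hzr⟩
          rw [← hzr, ← Complex.ofReal_sub, Complex.norm_real] at hzn
          simpa using hzn)
    rw [hval, Finset.sum_image (fun a _ b _ hab => Subtype.ext (Complex.ofReal_injective hab)),
      neg_add_eq_sub] at h1
    rw [Real.dist_eq, ← Real.norm_eq_abs, ← Complex.norm_real]
    convert h1 using 2
    push_cast
    rfl

/-! ### Enumeration of the zeros and partial fractions -/

/-- Infinitude makes each set under `sInf` nonempty, and local finiteness makes its infimum a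
minimum. No point is skipped: if `n` is least with `x ≤ a n`, then `a n` is the least point beyond
`a (n - 1)`, hence equals `x`. -/
theorem strictMono_and_image_of_sInf_succ {a : ℕ → ℝ} {P : ℝ → Prop} (h0 : a 0 = 0)
    (hsucc : ∀ n, a (n + 1) = sInf {x | a n < x ∧ P x})
    (hfin : ∀ R : ℝ, {x | 0 < x ∧ P x ∧ x ≤ R}.Finite) (hinf : {x | 0 < x ∧ P x}.Infinite) :
    StrictMono a ∧ a '' {n | 1 ≤ n} = {x | 0 < x ∧ P x} := by
  have hleast : ∀ n, 0 ≤ a n → IsLeast {x | a n < x ∧ P x} (a (n + 1)) := by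
    intro n hn
    obtain ⟨y, hy, hyn⟩ : ∃ y, (0 < y ∧ P y) ∧ a n < y := by
      by_contra! hcon
      exact hinf ((hfin (a n)).subset fun y hy => ⟨hy.1, hy.2, hcon y hy⟩)
    have hfin' : {x | (a n < x ∧ P x) ∧ x ≤ y}.Finite :=
      (hfin y).subset fun x hx => ⟨hn.trans_lt hx.1.1, hx.1.2, hx.2⟩
    obtain ⟨m, hm, hmin⟩ := Set.exists_min_image _ id hfin' ⟨y, ⟨hyn, hy.2⟩, le_rfl⟩
    have hl : IsLeast {x | a n < x ∧ P x} m := by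
      refine ⟨hm.1, fun x hx => ?_⟩
      rcases le_total x y with hxy | hxy
      · exact hmin x ⟨hx, hxy⟩
      · exact hm.2.trans hxy
    rw [hsucc, hl.csInf_eq]
    exact hl
  have hnn : ∀ n, 0 ≤ a n := fun n => by
    induction n with
    | zero => exact h0.ge
    | succ n ih => exact ih.trans (hleast n ih).1.1.le
  have hmono : StrictMono a := strictMono_nat_of_lt_succ fun n => (hleast n (hnn n)).1.1
  refine ⟨hmono, Set.Subset.antisymm ?_ ?_⟩
  · rintro _ ⟨n, hn, rfl⟩
    obtain ⟨m, rfl⟩ := Nat.exists_eq_add_of_le' hn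
    exact ⟨(hnn m).trans_lt (hleast m (hnn m)).1.1, (hleast m (hnn m)).1.2⟩
  · rintro x ⟨hx, hPx⟩
    obtain ⟨n, hn⟩ : ∃ n, x ≤ a n := by
      by_contra! hcon
      refine Set.infinite_range_of_injective (f := fun n => a (n + 1))
        (fun m n hmn => by simpa using hmono.injective hmn) ((hfin x).subset ?_)
      rintro _ ⟨n, rfl⟩
      exact ⟨(hnn n).trans_lt (hleast n (hnn n)).1.1, (hleast n (hnn n)).1.2, (hcon _).le⟩
    classical
    have hex : ∃ n, x ≤ a n := ⟨n, hn⟩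
    rcases hm : Nat.find hex with _ | m
    · have := Nat.find_spec hex
      rw [hm, h0] at this
      exact absurd hx this.not_gt
    · have h1 : a m < x := not_le.1 (Nat.find_min hex (by omega))
      have h2 := Nat.find_spec hex
      rw [hm] at h2
      exact ⟨m + 1, by simp, le_antisymm ((hleast m (hnn m)).2 ⟨h1, hPx⟩) h2⟩

/-- From `∑ 1 / (a_n ^ 2 - a_k ^ 2)` to `∑ 1 / (a_n ^ 4 - a_k ^ 4)`, by partial fractions. -/
theorem hasSum_one_div_pow_four_sub {a : ℕ → ℝ} {p : ℕ → Prop} {k : ℕ} {A : ℝ} (hk : p k)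
    (hpos : ∀ n, p n → 0 < a n) (hinj : Set.InjOn a {n | p n})
    (hA : HasSum (fun n : {n : ℕ // p n ∧ n ≠ k} => 1 / (a n ^ 2 - a k ^ 2)) A) :
    Summable (fun n : {n : ℕ // p n} => 1 / (a n ^ 2 + a k ^ 2)) ∧
    HasSum (fun n : {n : ℕ // p n ∧ n ≠ k} => 1 / (a n ^ 4 - a k ^ 4))
      (1 / (2 * a k ^ 2) *
        (A - (∑' n : {n : ℕ // p n}, 1 / (a n ^ 2 + a k ^ 2)) + 1 / (2 * a k ^ 2))) := by
  classical
  have hak := hpos k hk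
  have hne : ∀ n, p n ∧ n ≠ k → a n ^ 2 - a k ^ 2 ≠ 0 := by
    rintro n ⟨hn, hnk⟩ h
    have h1 := (pow_left_inj₀ (hpos n hn).le hak.le two_ne_zero).1 (sub_eq_zero.1 h)
    exact hnk (hinj hn hk h1)
  -- Comparison: `|a_n² - a_k²| ≤ a_n² + a_k²`.
  have hB : Summable fun n : {n : ℕ // p n ∧ n ≠ k} => 1 / (a n ^ 2 + a k ^ 2) := by
    refine Summable.of_norm_bounded hA.summable.norm fun n => ?_
    have h1 := abs_pos.2 (hne n n.2)
    have h2 : 0 < a n ^ 2 + a k ^ 2 := by positivity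
    rw [norm_div, norm_div, Real.norm_of_nonneg h2.le, Real.norm_eq_abs (_ - _)]
    refine div_le_div_of_nonneg_left (norm_nonneg _) h1 (abs_le.2 ⟨?_, ?_⟩) <;>
      nlinarith [sq_nonneg (a n), sq_nonneg (a k)]
  -- The full sum includes `n = k`; its term `1 / (2 a_k²)` is the correction in the conclusion.
  have hall : HasSum (fun n : {n : ℕ // p n} => 1 / (a n ^ 2 + a k ^ 2))
      ((∑' n : {n : ℕ // p n ∧ n ≠ k}, 1 / (a n ^ 2 + a k ^ 2)) + 1 / (2 * a k ^ 2)) := by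
    have h1 := (hasSum_subtype_iff_indicator (s := {n | p n ∧ n ≠ k})
      (f := fun n => 1 / (a n ^ 2 + a k ^ 2))).1 hB.hasSum
    have h2 := h1.add (hasSum_ite_eq k (1 / (2 * a k ^ 2)))
    refine (hasSum_subtype_iff_indicator (s := {n | p n})
      (f := fun n => 1 / (a n ^ 2 + a k ^ 2))).2 ?_
    convert h2 using 1
    funext n
    by_cases hn : n = k
    · subst hn
      simp [Set.indicator, hk, two_mul]
    · simp [Set.indicator, hn]
  refine ⟨hall.summable, ?_⟩
  rw [hall.tsum_eq]
  have h3 := (hA.sub hB.hasSum).mul_left (1 / (2 * a k ^ 2))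
  have e : 1 / (2 * a k ^ 2) * (A - ∑' n : {n : ℕ // p n ∧ n ≠ k}, 1 / (a n ^ 2 + a k ^ 2))
      = 1 / (2 * a k ^ 2) * (A - ((∑' n : {n : ℕ // p n ∧ n ≠ k}, 1 / (a n ^ 2 + a k ^ 2))
        + 1 / (2 * a k ^ 2)) + 1 / (2 * a k ^ 2)) := by ring
  rw [← e]
  have e2 : (fun n : {n : ℕ // p n ∧ n ≠ k} => 1 / (a n ^ 4 - a k ^ 4))
      = fun n : {n : ℕ // p n ∧ n ≠ k} =>
        1 / (2 * a k ^ 2) * (1 / (a n ^ 2 - a k ^ 2) - 1 / (a n ^ 2 + a k ^ 2)) := by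
    funext n
    have h4 := hne n n.2
    have h5 : a n ^ 2 + a k ^ 2 ≠ 0 := by positivity
    have h6 : a n ^ 4 - a k ^ 4 = (a n ^ 2 - a k ^ 2) * (a n ^ 2 + a k ^ 2) := by ring
    rw [h6]
    field_simp
    ring
  rw [e2]
  exact h3

theorem besselJ_eq {ν : ℝ} {x : ℝ} (hx : 0 < x) :
    besselJ ν x = (x / 2) ^ ν * ∑' m : ℕ, besselCoeff ν m * (x ^ 2 / 4) ^ m := by
  rw [besselJ, ← tsum_mul_left]
  refine tsum_congr fun m => ?_
  have h1 : (x / 2) ^ (2 * (m : ℝ) + ν) = (x / 2) ^ ν * (x ^ 2 / 4) ^ m := by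
    rw [Real.rpow_add (by positivity), mul_comm]
    congr 1
    rw [show (2 * (m : ℝ)) = ((2 * m : ℕ) : ℝ) by push_cast; ring, Real.rpow_natCast, pow_mul]
    congr 1
    ring
  rw [h1, besselCoeff]
  ring

theorem besselJ_eq_zero_iff {ν : ℝ} {x : ℝ} (hx : 0 < x) :
    besselJ ν x = 0 ↔ besselEntire ν ((x ^ 2 / 4 : ℝ) : ℂ) = 0 := by
  rw [besselJ_eq hx, besselEntire_ofReal, Complex.ofReal_eq_zero, mul_eq_zero, or_iff_right]
  exact (Real.rpow_pos_of_pos (by positivity) ν).ne'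

theorem besselJZero_enumerates {ν : ℝ} (hν : -1 < ν) :
    StrictMono (besselJZero ν) ∧
      besselJZero ν '' {n : ℕ | 1 ≤ n} = {x : ℝ | 0 < x ∧ besselJ ν x = 0} := by
  refine strictMono_and_image_of_sInf_succ (P := fun x => besselJ ν x = 0) rfl (fun n => rfl) ?_ ?_
  · intro R
    have h1 := Complex.finite_zeros_inter_closedBall (differentiable_besselEntire hν)
      (besselEntire_zero hν) 0 (R ^ 2 / 4)
    refine Set.Finite.of_injOn (f := fun x : ℝ => ((x ^ 2 / 4 : ℝ) : ℂ)) ?_ ?_ h1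
    · rintro x ⟨hx, hJ, hxR⟩
      refine ⟨(besselJ_eq_zero_iff hx).1 hJ, ?_⟩
      rw [sub_zero, Complex.norm_real, Real.norm_of_nonneg (by positivity)]
      gcongr
    · rintro x ⟨hx, -⟩ y ⟨hy, -⟩ hxy
      have h2 := Complex.ofReal_injective hxy
      exact (pow_left_inj₀ hx.le hy.le two_ne_zero).1 (by linarith)
  · intro hfin
    refine besselEntire_zeros_infinite hν ((hfin.image fun x : ℝ => ((x ^ 2 / 4 : ℝ) : ℂ)).subset ?_)
    intro z hz
    have hre := besselEntire_zero_re hν hz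
    have hx : 0 < 2 * √z.re := by positivity
    have hz' : (((2 * √z.re) ^ 2 / 4 : ℝ) : ℂ) = z := by
      rw [mul_pow, Real.sq_sqrt hre.le]
      exact Complex.ext (by rw [Complex.ofReal_re]; ring)
        (by rw [Complex.ofReal_im, besselEntire_zero_im hν hz])
    exact ⟨2 * √z.re, ⟨hx, (besselJ_eq_zero_iff hx).2 (by rw [hz']; exact hz)⟩, hz'⟩

theorem besselJZero_pos {ν : ℝ} (hν : -1 < ν) {n : ℕ} (hn : 1 ≤ n) : 0 < besselJZero ν n :=
  ((besselJZero_enumerates hν).2.subset ⟨n, hn, rfl⟩).1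

/-- The map `n ↦ j_n² / 4` is a bijection onto the zeros of `Λ`, and it rescales the sum by `1 / 4`.
-/
theorem hasSum_inv_sub_besselJZero {ν : ℝ} (hν : -1 < ν) {k : ℕ} (hk : 1 ≤ k) :
    HasSum (fun n : {n : ℕ // 1 ≤ n ∧ n ≠ k} => 1 / (besselJZero ν n ^ 2 - besselJZero ν k ^ 2))
      ((ν + 1) / (2 * besselJZero ν k ^ 2)) := by
  obtain ⟨hmono, himg⟩ := besselJZero_enumerates hν
  have hzero : ∀ n, 1 ≤ n → besselEntire ν ((besselJZero ν n ^ 2 / 4 : ℝ) : ℂ) = 0 := fun n hn =>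
    (besselJ_eq_zero_iff (besselJZero_pos hν hn)).1 (himg.subset ⟨n, hn, rfl⟩).2
  have hinj : ∀ m n, 1 ≤ m → 1 ≤ n → besselJZero ν m ^ 2 / 4 = besselJZero ν n ^ 2 / 4 → m = n :=
    fun m n hm hn h => hmono.injective ((pow_left_inj₀ (besselJZero_pos hν hm).le
      (besselJZero_pos hν hn).le two_ne_zero).1 (by linarith))
  set x : ℝ := besselJZero ν k ^ 2 / 4 with hx
  let e : {n : ℕ // 1 ≤ n ∧ n ≠ k} → {y : ℝ // besselEntire ν y = 0 ∧ y ≠ x} := fun n =>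
    ⟨besselJZero ν n ^ 2 / 4, hzero n n.2.1, fun h => n.2.2 (hinj _ _ n.2.1 hk h)⟩
  have he : Function.Bijective e := by
    constructor
    · intro m n hmn
      exact Subtype.ext (hinj _ _ m.2.1 n.2.1 (congrArg Subtype.val hmn))
    · rintro ⟨y, hy, hyx⟩
      have hy0 : 0 < y := by simpa using besselEntire_zero_re hν hy
      have hpos : 0 < 2 * √y := by positivity
      have hsq : (2 * √y) ^ 2 / 4 = y := by
        rw [mul_pow, Real.sq_sqrt hy0.le]; ring
      obtain ⟨n, hn, hny⟩ := himg.superset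
        ⟨hpos, (besselJ_eq_zero_iff hpos).2 (by rw [hsq]; exact hy)⟩
      rw [← hny] at hsq
      exact ⟨⟨n, hn, fun h => hyx (by rw [← hsq, h])⟩, Subtype.ext hsq⟩
  have h1 := (Equiv.ofBijective e he).hasSum_iff.2
    (hasSum_inv_sub_besselEntire_zeros hν (hzero k hk))
  have h2 := h1.mul_left (1 / 4)
  have hk0 := besselJZero_pos hν hk
  have e1 : (1 / 4 : ℝ) * ((ν + 1) / (2 * x)) = (ν + 1) / (2 * besselJZero ν k ^ 2) := by
    rw [hx]; field_simp
  rw [← e1]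
  have e2 : (fun n : {n : ℕ // 1 ≤ n ∧ n ≠ k} =>
      1 / (besselJZero ν n ^ 2 - besselJZero ν k ^ 2)) = fun n : {n : ℕ // 1 ≤ n ∧ n ≠ k} =>
      1 / 4 * (besselJZero ν n ^ 2 / 4 - x)⁻¹ := by
    funext n
    rw [hx, show besselJZero ν n ^ 2 / 4 - besselJZero ν k ^ 2 / 4
      = (besselJZero ν n ^ 2 - besselJZero ν k ^ 2) / 4 by ring, inv_div]
    ring
  rw [e2]
  exact h2

/-! ### Quadratic series over the integers and the odd integers -/

theorem tendsto_sum_range_sub_shift {D : ℕ → ℝ} (hD : Tendsto D atTop (𝓝 0)) (m : ℕ) :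
    Tendsto (fun N => ∑ n ∈ Finset.range N, (D n - D (n + m))) atTop
      (𝓝 (∑ n ∈ Finset.range m, D n)) := by
  have h1 : ∀ N, ∑ n ∈ Finset.range N, (D n - D (n + m))
      = ∑ n ∈ Finset.range m, D n - ∑ n ∈ Finset.range m, D (N + n) := fun N => by
    have h2 := Finset.sum_range_add D N m
    have h3 := Finset.sum_range_add D m N
    rw [add_comm m N] at h3
    simp only [Finset.sum_sub_distrib, add_comm _ m]
    linarith
  simp only [h1]
  have h4 : Tendsto (fun N => ∑ n ∈ Finset.range m, D (N + n)) atTop (𝓝 (∑ n ∈ Finset.range m, 0)) :=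
    tendsto_finsetSum _ fun n _ => hD.comp (tendsto_add_atTop_nat n)
  simpa using tendsto_const_nhds.sub h4

/-- The reflection `n ↦ 2k - n` cancels everything but `n = 0`; the fixed term `n = k` is `1 / 0 =
0`. -/
theorem sum_range_two_mul_inv_sub {k : ℕ} (hk : 1 ≤ k) :
    ∑ n ∈ Finset.range (2 * k), 1 / ((n : ℝ) - k) = -1 / k := by
  obtain ⟨l, rfl⟩ := Nat.exists_eq_add_of_le' hk
  rw [show 2 * (l + 1) = (2 * l + 1) + 1 by ring, Finset.sum_range_succ']
  have h1 : ∑ n ∈ Finset.range (2 * l + 1), 1 / (((n + 1 : ℕ) : ℝ) - ((l + 1 : ℕ) : ℝ))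
      = -∑ n ∈ Finset.range (2 * l + 1), 1 / (((n + 1 : ℕ) : ℝ) - ((l + 1 : ℕ) : ℝ)) := by
    rw [← Finset.sum_neg_distrib]
    refine (Finset.sum_range_reflect _ _).symm.trans (Finset.sum_congr rfl fun n hn => ?_)
    have hn' : n ≤ 2 * l := by have := Finset.mem_range.1 hn; omega
    rw [show 2 * l + 1 - 1 - n = 2 * l - n by omega]
    push_cast [hn']
    rw [← one_div_neg_eq_neg_one_div]
    congr 1
    ring
  have h4 : ∑ n ∈ Finset.range (2 * l + 1), 1 / (((n + 1 : ℕ) : ℝ) - ((l + 1 : ℕ) : ℝ)) = 0 := by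
    linarith
  rw [h4]
  push_cast
  rw [zero_add, zero_sub, one_div_neg_eq_neg_one_div, neg_div]

/-- The term at `n = k` is `1 / 0 = 0`. -/
theorem hasSum_nat_one_div_sq_sub {k : ℕ} (hk : 1 ≤ k) :
    HasSum (fun n : ℕ => 1 / ((n : ℝ) ^ 2 - (k : ℝ) ^ 2)) (-1 / (4 * (k : ℝ) ^ 2)) := by
  have hk0 : (0 : ℝ) < k := by exact_mod_cast hk
  set D : ℕ → ℝ := fun n => 1 / ((n : ℝ) - k) with hD
  have hDlim : Tendsto D atTop (𝓝 0) := tendsto_const_nhds.div_atTop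
    (tendsto_atTop_add_const_right _ (-(k : ℝ)) tendsto_natCast_atTop_atTop)
  have hlim := tendsto_sum_range_sub_shift hDlim (2 * k)
  rw [sum_range_two_mul_inv_sub hk] at hlim
  -- At `n = k` the left side and `D k` are `0` by convention, but `D (3k) = 1 / (2k)` remains and
  -- must be compensated.
  have hterm : ∀ n : ℕ, 1 / ((n : ℝ) ^ 2 - (k : ℝ) ^ 2)
      = 1 / (2 * k) * (D n - D (n + 2 * k) + if n = k then 1 / (2 * (k : ℝ)) else 0) := by
    intro n
    simp only [hD]
    have h2 : (((n + 2 * k : ℕ) : ℝ) - k) = n + k := by push_cast; ring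
    have h3 : (0 : ℝ) < n + k := by positivity
    rw [h2]
    split_ifs with hn
    · subst hn
      rw [sub_self, sub_self]
      field_simp
      ring
    · have h4 : (n : ℝ) - k ≠ 0 := sub_ne_zero.2 (by exact_mod_cast hn)
      rw [sq_sub_sq]
      field_simp
      ring
  refine hasSum_of_tendsto_of_finite_neg (S := Finset.range) Finset.range_mono
    (fun n => ⟨n + 1, by simp⟩) ?_ ?_
  · refine (Set.finite_lt_nat k).subset fun n hn => ?_
    by_contra hkn
    have : (k : ℝ) ≤ n := by exact_mod_cast not_lt.1 hkn
    have h5 : 0 ≤ (n : ℝ) ^ 2 - (k : ℝ) ^ 2 := by nlinarith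
    exact (not_lt.2 (one_div_nonneg.2 h5)) hn
  · have h6 : Tendsto (fun N => ∑ n ∈ Finset.range N, if n = k then 1 / (2 * (k : ℝ)) else 0) atTop
        (𝓝 (1 / (2 * (k : ℝ)))) := (hasSum_ite_eq k (1 / (2 * (k : ℝ)))).tendsto_sum_nat
    have h7 := (hlim.add h6).const_mul (1 / (2 * (k : ℝ)))
    have e : 1 / (2 * (k : ℝ)) * (-1 / k + 1 / (2 * (k : ℝ))) = -1 / (4 * (k : ℝ) ^ 2) := by
      field_simp; ring
    rw [e] at h7
    refine h7.congr fun N => ?_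
    rw [← Finset.sum_add_distrib, Finset.mul_sum]
    exact Finset.sum_congr rfl fun n _ => (hterm n).symm

theorem I_mul_cot_mul_I {y : ℝ} (hy : 0 < y) :
    Complex.I / (2 * y) * (Real.pi * Complex.cot (Real.pi * (y * Complex.I)) - 1 / (y * Complex.I))
      = ((Real.pi / (2 * y) * (Real.cosh (Real.pi * y) / Real.sinh (Real.pi * y))
        - 1 / (2 * y ^ 2) : ℝ) : ℂ) := by
  have hyc : (y : ℂ) ≠ 0 := by exact_mod_cast hy.ne'
  have hs : (Complex.sinh (Real.pi * y) : ℂ) ≠ 0 := by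
    rw [← Complex.ofReal_mul, ← Complex.ofReal_sinh, Complex.ofReal_ne_zero]
    exact (Real.sinh_pos_iff.2 (by positivity)).ne'
  have hI := Complex.I_ne_zero
  rw [Complex.cot, ← mul_assoc, Complex.cos_mul_I, Complex.sin_mul_I]
  push_cast
  generalize Complex.sinh (Real.pi * y) = s at *
  generalize Complex.cosh (Real.pi * y) = c
  have h1 : (Real.pi : ℂ) * (c / (s * Complex.I)) - 1 / (y * Complex.I)
      = (Real.pi * (c / s) - 1 / y) / Complex.I := by
    field_simp
  rw [h1]
  field_simp

/-- The cotangent series at `z = iy`, times `i / (2y)`. It starts at `n = 1`; adding `1 / y²` for `n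
= 0` turns `-1 / (2y²)` into `+1 / (2y²)`. -/
theorem hasSum_nat_one_div_sq_add {y : ℝ} (hy : 0 < y) :
    HasSum (fun n : ℕ => 1 / ((n : ℝ) ^ 2 + y ^ 2))
      (Real.pi / (2 * y) * (Real.cosh (Real.pi * y) / Real.sinh (Real.pi * y))
        + 1 / (2 * y ^ 2)) := by
  have hyc : (y : ℂ) ≠ 0 := by exact_mod_cast hy.ne'
  set z : ℂ := y * Complex.I with hz
  have hzi : z ∈ Complex.integerComplement := by
    rintro ⟨n, hn⟩
    have := congrArg Complex.im hn
    simp [hz] at this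
    exact hy.ne this
  have h1 := (summable_cotTerm hzi).hasSum
  rw [← cot_series_rep' hzi] at h1
  have h2 := h1.mul_left (Complex.I / (2 * y))
  have hterm : ∀ n : ℕ, Complex.I / (2 * y) * cotTerm z n
      = ((1 / (((n + 1 : ℕ) : ℝ) ^ 2 + y ^ 2) : ℝ) : ℂ) := by
    intro n
    have h3 : ((((n + 1 : ℕ) : ℝ) ^ 2 + y ^ 2 : ℝ) : ℂ) ≠ 0 :=
      Complex.ofReal_ne_zero.2 (by positivity)
    have h4 : (z + (n + 1)) * (z - (n + 1)) = -((((n + 1 : ℕ) : ℝ) ^ 2 + y ^ 2 : ℝ) : ℂ) := by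
      rw [hz]
      push_cast
      linear_combination (y : ℂ) ^ 2 * Complex.I_sq
    rw [cotTerm_identity hzi, h4, Complex.ofReal_div, Complex.ofReal_one, hz]
    field_simp
    linear_combination -Complex.I_sq
  rw [I_mul_cot_mul_I hy, funext hterm] at h2
  have h5 := (hasSum_nat_add_iff (f := fun n : ℕ => 1 / ((n : ℝ) ^ 2 + y ^ 2)) 1).1
    (Complex.hasSum_ofReal.1 h2)
  have e : Real.pi / (2 * y) * (Real.cosh (Real.pi * y) / Real.sinh (Real.pi * y))
        - 1 / (2 * y ^ 2) + ∑ n ∈ Finset.range 1, 1 / ((n : ℝ) ^ 2 + y ^ 2)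
      = Real.pi / (2 * y) * (Real.cosh (Real.pi * y) / Real.sinh (Real.pi * y))
        + 1 / (2 * y ^ 2) := by
    rw [Finset.sum_range_one]
    push_cast
    field_simp
    ring
  rwa [e] at h5

theorem coth_sub_half_coth_half {x : ℝ} (hx : 0 < x) :
    Real.cosh (2 * x) / Real.sinh (2 * x) - 1 / 2 * (Real.cosh x / Real.sinh x)
      = 1 / 2 * Real.tanh x := by
  have hs := (Real.sinh_pos_iff.2 hx).ne'
  have hc := (Real.cosh_pos x).ne'
  rw [Real.cosh_two_mul, Real.sinh_two_mul, Real.tanh_eq_sinh_div_cosh]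
  field_simp
  ring

theorem hasSum_odd_of_hasSum_nat {F : ℕ → ℝ} {A E : ℝ} (hA : HasSum F A)
    (hE : HasSum (fun m => F (2 * m)) E) : HasSum (fun n : {n : ℕ // Odd n} => F n) (A - E) := by
  have hO : Summable fun m => F (2 * m + 1) :=
    hA.summable.comp_injective (i := fun m => 2 * m + 1) (fun a b h => by simpa using h)
  have h1 : A - E = ∑' m, F (2 * m + 1) := by
    rw [(hE.even_add_odd hO.hasSum).unique hA |>.symm]
    ring
  rw [h1]
  let e : ℕ → {n : ℕ // Odd n} := fun m => ⟨2 * m + 1, m, rfl⟩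
  have he : Function.Bijective e := by
    constructor
    · intro a b h
      have := congrArg Subtype.val h
      simp only [e] at this
      omega
    · rintro ⟨n, m, rfl⟩
      exact ⟨m, rfl⟩
  exact (Equiv.ofBijective e he).hasSum_iff.1 hO.hasSum

/-- The even terms are a quarter of the full series at `y / 2`; subtracting them leaves `tanh` by
the duplication formulas. -/
theorem hasSum_odd_one_div_sq_add {y : ℝ} (hy : 0 < y) :
    HasSum (fun n : {n : ℕ // Odd n} => 1 / (((n : ℕ) : ℝ) ^ 2 + y ^ 2))
      (Real.pi / (4 * y) * Real.tanh (Real.pi * y / 2)) := by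
  have h2 := (hasSum_nat_one_div_sq_add (half_pos hy)).mul_left (1 / 4)
  have e2 : (fun n : ℕ => 1 / 4 * (1 / ((n : ℝ) ^ 2 + (y / 2) ^ 2)))
      = fun n : ℕ => 1 / (((2 * n : ℕ) : ℝ) ^ 2 + y ^ 2) := by
    funext n
    push_cast
    field_simp
    ring
  rw [e2] at h2
  have h3 := hasSum_odd_of_hasSum_nat (hasSum_nat_one_div_sq_add hy) h2
  have e3 := coth_sub_half_coth_half (x := Real.pi * y / 2) (by positivity)
  rw [show 2 * (Real.pi * y / 2) = Real.pi * y by ring] at e3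
  rw [show Real.pi * (y / 2) = Real.pi * y / 2 by ring] at h3
  convert h3 using 1
  have : Real.tanh (Real.pi * y / 2) = 2 * (1 / 2 * Real.tanh (Real.pi * y / 2)) := by ring
  rw [this, ← e3]
  field_simp
  ring

/-- The even terms come from the cotangent series at `k / 2`, where the cotangent vanishes because
`k` is odd. -/
theorem hasSum_odd_one_div_sq_sub {k : ℕ} (hk : Odd k) :
    HasSum (fun n : {n : ℕ // Odd n} => 1 / (((n : ℕ) : ℝ) ^ 2 - (k : ℝ) ^ 2))
      (1 / (4 * (k : ℝ) ^ 2)) := by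
  have hk1 : 1 ≤ k := hk.pos
  have hk0 : (0 : ℝ) < k := by exact_mod_cast hk1
  obtain ⟨l, hl⟩ := hk
  have hz : ((k : ℂ) / 2) ∈ Complex.integerComplement := by
    rintro ⟨n, hn⟩
    have h1 : (2 * n : ℂ) = k := by rw [hn]; ring
    have h2 : 2 * n = (k : ℤ) := by exact_mod_cast h1
    omega
  have hkc : (k : ℂ) ≠ 0 := by exact_mod_cast hk0.ne'
  have hcot : Complex.cot (Real.pi * ((k : ℂ) / 2)) = 0 := by
    have h1 : Complex.cos (Real.pi * ((k : ℂ) / 2)) = 0 :=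
      Complex.cos_eq_zero_iff.2 ⟨l, by rw [hl]; push_cast; ring⟩
    rw [Complex.cot, h1, zero_div]
  have h1 := (summable_cotTerm hz).hasSum
  rw [← cot_series_rep' hz, hcot] at h1
  have h2 := h1.mul_left (-1 / (4 * (k : ℂ)))
  have hterm : ∀ n : ℕ, -1 / (4 * (k : ℂ)) * cotTerm ((k : ℂ) / 2) n
      = ((1 / (((2 * (n + 1) : ℕ) : ℝ) ^ 2 - (k : ℝ) ^ 2) : ℝ) : ℂ) := by
    intro n
    have h4 : ((k : ℂ) / 2 + (n + 1)) * ((k : ℂ) / 2 - (n + 1))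
        = -((((2 * (n + 1) : ℕ) : ℝ) ^ 2 - (k : ℝ) ^ 2 : ℝ) : ℂ) / 4 := by
      push_cast
      ring
    have h3 : ((((2 * (n + 1) : ℕ) : ℝ) ^ 2 - (k : ℝ) ^ 2 : ℝ) : ℂ) ≠ 0 := by
      refine Complex.ofReal_ne_zero.2 (sub_ne_zero.2 fun h => ?_)
      have h5 : 2 * (n + 1) = k := by
        have := (pow_left_inj₀ (by positivity) hk0.le two_ne_zero).1 h
        exact_mod_cast this
      omega
    rw [cotTerm_identity hz, h4, Complex.ofReal_div, Complex.ofReal_one]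
    field_simp
  have hval : -1 / (4 * (k : ℂ)) * (Real.pi * 0 - 1 / ((k : ℂ) / 2))
      = ((1 / (2 * (k : ℝ) ^ 2) : ℝ) : ℂ) := by
    push_cast
    field_simp
    norm_num
  rw [hval, funext hterm] at h2
  have h5 := (hasSum_nat_add_iff (f := fun n : ℕ => 1 / (((2 * n : ℕ) : ℝ) ^ 2 - (k : ℝ) ^ 2)) 1).1
    (Complex.hasSum_ofReal.1 h2)
  have h6 := hasSum_odd_of_hasSum_nat (hasSum_nat_one_div_sq_sub hk1) h5
  convert h6 using 1
  rw [Finset.sum_range_one]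
  push_cast
  field_simp
  ring

/-- Applied where `F k = 1 / 0 = 0`, so removing the index `k` costs nothing. -/
theorem hasSum_ne_of_hasSum {F : ℕ → ℝ} {p : ℕ → Prop} {k : ℕ} {A : ℝ} (hF : F k = 0)
    (hA : HasSum (fun n : {n : ℕ // p n} => F n) A) :
    HasSum (fun n : {n : ℕ // p n ∧ n ≠ k} => F n) A := by
  classical
  have h1 := (hasSum_subtype_iff_indicator (s := {n | p n}) (f := F)).1 hA
  refine (hasSum_subtype_iff_indicator (s := {n | p n ∧ n ≠ k}) (f := F)).2 ?_
  convert h1 using 1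
  funext n
  by_cases hn : n = k
  · subst hn
    simp [Set.indicator, hF]
  · simp [Set.indicator, hn]

theorem hasSum_pos_of_hasSum_nat {F : ℕ → ℝ} {A : ℝ} (hA : HasSum F A) :
    HasSum (fun n : {n : ℕ // 1 ≤ n} => F n) (A - F 0) := by
  refine (hasSum_subtype_iff_indicator (s := {n | 1 ≤ n}) (f := F)).2 ?_
  have h := hA.sub (hasSum_ite_eq 0 (F 0))
  have e : ({n | 1 ≤ n} : Set ℕ).indicator F = fun n => F n - if n = 0 then F 0 else 0 := by
    funext n
    rcases n with _ | n <;> simp [Set.indicator]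
  rw [e]
  exact h


end

/-! ### The main theorem -/

theorem theorem1 :
    (∀ ν : ℝ, -1 < ν →
      -- the positive zeros of `J_ν` are exactly `j_{ν,1} < j_{ν,2} < ⋯`
      (StrictMono (besselJZero ν) ∧
        besselJZero ν '' {n : ℕ | 1 ≤ n} = {x : ℝ | 0 < x ∧ besselJ ν x = 0}) ∧
      ∀ k : ℕ, 1 ≤ k →
        Summable (fun n : {n : ℕ // 1 ≤ n} =>
          1 / (besselJZero ν n ^ 2 + besselJZero ν k ^ 2)) ∧
        HasSum (fun n : {n : ℕ // 1 ≤ n ∧ n ≠ k} =>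
            1 / (besselJZero ν n ^ 4 - besselJZero ν k ^ 4))
          (-(1 / (2 * besselJZero ν k ^ 2)) *
              (∑' n : {n : ℕ // 1 ≤ n}, 1 / (besselJZero ν n ^ 2 + besselJZero ν k ^ 2))
            + (ν + 2) / (4 * besselJZero ν k ^ 4))) ∧
    (∀ k : ℕ, 1 ≤ k →
      HasSum (fun n : {n : ℕ // 1 ≤ n ∧ n ≠ k} => 1 / (((n : ℕ) : ℝ) ^ 4 - (k : ℝ) ^ 4))
        (-(Real.pi / (4 * (k : ℝ) ^ 3)) * (Real.cosh (k * Real.pi) / Real.sinh (k * Real.pi))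
          + 7 / (8 * (k : ℝ) ^ 4))) ∧
    (∀ k : ℕ, Odd k →
      HasSum (fun n : {n : ℕ // Odd n ∧ n ≠ k} => 1 / (((n : ℕ) : ℝ) ^ 4 - (k : ℝ) ^ 4))
        (-(Real.pi / (8 * (k : ℝ) ^ 3)) * Real.tanh (k * Real.pi / 2)
          + 3 / (8 * (k : ℝ) ^ 4))) := by
  refine ⟨fun ν hν => ⟨besselJZero_enumerates hν, fun k hk => ?_⟩, fun k hk => ?_, fun k hk => ?_⟩
  · obtain ⟨h1, h2⟩ := hasSum_one_div_pow_four_sub (p := fun n => 1 ≤ n) hk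
      (fun n hn => besselJZero_pos hν hn) (besselJZero_enumerates hν).1.injective.injOn
      (hasSum_inv_sub_besselJZero hν hk)
    refine ⟨h1, ?_⟩
    have hk0 := besselJZero_pos hν hk
    convert h2 using 1
    field_simp
    ring
  -- Dropping `n = 0` gives `3/(4k²)` for the difference series and `π coth(kπ)/(2k) - 1/(2k²)` for
  -- the other; `3/4 + 1/2 + 1/2 = 7/4` becomes `7/8`.
  · have hk0 : (0 : ℝ) < k := by exact_mod_cast hk
    obtain ⟨-, h2⟩ := hasSum_one_div_pow_four_sub (a := fun n => (n : ℝ)) (p := fun n => 1 ≤ n) hk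
      (fun n hn => by exact_mod_cast hn) Nat.cast_injective.injOn
      (hasSum_ne_of_hasSum (F := fun n : ℕ => 1 / ((n : ℝ) ^ 2 - (k : ℝ) ^ 2)) (by simp)
        (hasSum_pos_of_hasSum_nat (hasSum_nat_one_div_sq_sub hk)))
    rw [(hasSum_pos_of_hasSum_nat (hasSum_nat_one_div_sq_add hk0)).tsum_eq] at h2
    convert h2 using 1
    rw [mul_comm (k : ℝ) Real.pi]
    push_cast
    field_simp
    ring
  · have hk0 : (0 : ℝ) < k := by exact_mod_cast hk.pos
    obtain ⟨-, h2⟩ := hasSum_one_div_pow_four_sub (a := fun n => (n : ℝ)) (p := fun n => Odd n) hk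
      (fun n hn => by exact_mod_cast hn.pos) Nat.cast_injective.injOn
      (hasSum_ne_of_hasSum (F := fun n : ℕ => 1 / ((n : ℝ) ^ 2 - (k : ℝ) ^ 2)) (by simp)
        (hasSum_odd_one_div_sq_sub hk))
    rw [(hasSum_odd_one_div_sq_add hk0).tsum_eq] at h2
    convert h2 using 1
    rw [mul_comm (k : ℝ) Real.pi]
    field_simp
    ring
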